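/- Let $d\ge 1$ and $1<p<\infty$. Let $B_d$ be the open unit ball of $\mathbb{C}^d$, $\overline{B}_d$ its closure, $\partial B_d$ the unit sphere, $\sigma$ the normalized Lebesgue measure on $\partial B_d$, and $\langle z,w\rangle=\sum_j z_j\overline{w_j}$. Let $H^p$ be the space of holomorphic functions $f$ on $B_d$ with $$\|f\|_{H^p}^p=\sup_{0<r<1}\int_{\partial B_d}|f(r\zeta)|^p\,d\sigma(\zeta)<\infty .$$ For $w\in B_d$ put $k_w(z)=(1-\langle z,w\rangle)^{-d}$ and $K_w=k_w/\|k_w\|_{H^p}$ ($z\in\overline{B}_d$), and for $\zeta\in\partial B_d$, $\delta>0$ let $Q(\zeta,\delta)=\{\xi\in\partial B_d: |1-\langle\zeta,\xi\rangle|\le\delta\}$ (a nonisotropic ball). Let $\mu$ be a finite positive Borel measure on $\overline{B}_d$. Then the following properties are equivalent: (i) there exists a constant $C>0$ such that $\int_{\overline{B}_d}|f|^p\,d\mu\ge C\|f\|_{H^p}^p$ for all $f\in C(\overline{B}_d)\cap H^p$; (ii) there exists a constant $C>0$ such that $\int_{\overline{B}_d}|K_w|^p\,d\mu\ge C$ for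 all $w\in B_d$; (iii) there exists a constant $C>0$ such that $\mu(Q)\ge C\,\sigma(Q)$ for all nonisotropic balls $Q=Q(\zeta,\delta)$, $\zeta\in\partial B_d$, $\delta>0$. In particular, if $\mu(\partial B_d)=0$ (that is, $\mu$ is a measure on the open ball $B_d$), then (i) fails. -/

import Mathlib

open MeasureTheory Metric
open scoped NNReal ENNReal

/-- The space `ℂ^d` with its Hermitian inner product and Euclidean norm. -/
abbrev CSpace (d : ℕ) : Type := EuclideanSpace ℂ (Fin d)

/-- The normalized Lebesgue (surface) measure `σ` of the unit sphere of `ℂ^d`,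
as a measure on `ℂ^d` carried by the sphere. -/
noncomputable def sphereMeasure (d : ℕ) : Measure (CSpace d) :=
  ((volume : Measure (CSpace d)).toSphere Set.univ)⁻¹ •
    ((volume : Measure (CSpace d)).toSphere).map Subtype.val

/-- The Hardy norm `‖f‖_{H^p}` with values in `[0, ∞]`:
`‖f‖_{H^p}^p` is the supremum over `0 < r < 1` of the integrals of `|f(rζ)|^p` over the sphere. -/
noncomputable def hardyNorm {d : ℕ} (p : ℝ) (f : CSpace d → ℂ) : ℝ≥0∞ :=
  (⨆ r ∈ Set.Ioo (0 : ℝ) 1, ∫⁻ ζ, ‖f (r • ζ)‖ₑ ^ p ∂(sphereMeasure d)) ^ (1 / p)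

/-- `f` belongs to the Hardy space `H^p` of the open unit ball. Only the values of `f` on the
ball matter. -/
def MemHardy {d : ℕ} (p : ℝ) (f : CSpace d → ℂ) : Prop :=
  DifferentiableOn ℂ f (ball 0 1) ∧ hardyNorm p f < ∞

/-- The Cauchy kernel `k_w(z) = (1 - ⟨z, w⟩)^{-d}`, where `⟨z, w⟩ = ∑ z_j conj(w_j)`
(Mathlib's `inner ℂ` is conjugate linear in its first argument). -/
noncomputable def cauchyKernel {d : ℕ} (w z : CSpace d) : ℂ :=
  1 / (1 - inner ℂ w z) ^ d

/-- The normalized Cauchy kernel `K_w = k_w / ‖k_w‖_{H^p}`. -/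
noncomputable def normalizedKernel {d : ℕ} (p : ℝ) (w z : CSpace d) : ℂ :=
  cauchyKernel w z / ((hardyNorm p (cauchyKernel w)).toReal : ℂ)

/-- The nonisotropic ball `Q(ζ, δ) = {ξ ∈ ∂B : |1 - ⟨ζ, ξ⟩| ≤ δ}`. -/
def nonisoBall {d : ℕ} (ζ : CSpace d) (δ : ℝ) : Set (CSpace d) :=
  {ξ ∈ sphere (0 : CSpace d) 1 | ‖1 - inner ℂ ξ ζ‖ ≤ δ}

/-- The reverse Carleson inequality for `H^p`: for some `C > 0`, the integral of `|f|^p` over the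
closed ball is at least `C ‖f‖_{H^p}^p` for all `f` in `H^p` that are continuous on the closed
ball. -/
def IsReverseCarleson {d : ℕ} (p : ℝ) (μ : Measure (CSpace d)) : Prop :=
  ∃ C : ℝ≥0, 0 < C ∧ ∀ f : CSpace d → ℂ, ContinuousOn f (closedBall 0 1) → MemHardy p f →
    (C : ℝ≥0∞) * hardyNorm p f ^ p ≤ ∫⁻ z in closedBall 0 1, ‖f z‖ₑ ^ p ∂μ

/-! Everything rests on two size estimates: `σ(Q(ζ, δ))` is comparable to `δ ^ d` for `δ ≤ 1`, and
`‖k_w‖ ^ p` is comparable to `(1 - |w|) ^ (d - d * p)`, which blows up at the sphere because `p >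
1`.

(i) ⇒ (ii) tests the inequality on Cauchy kernels. For (iii) ⇒ (ii), with `w = |w|ζ`, keep only the
part of the integral over `Q(ζ, 1 - |w|)`, where `|1 - ⟨z, w⟩| ≤ 2 (1 - |w|)`; the powers of `1 -
|w|` cancel.

The core is `mul_lintegral_sphereMeasure_le`: (ii) forces `C ∫ H dσ ≤ ∫_{∂B} H dμ` for bounded `H ≥
0` continuous on the sphere. Multiply (ii) at `w = r_n ζ` by `H(ζ)`, integrate in `ζ` and use
Tonelli. As `r_n → 1` the inner averages of `H` have limsup at most `H` on the sphere and `0` inside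
the ball, because `|k_w(z)| = |k_z(w)|` and the norms tend to infinity; reverse Fatou concludes.
Taking `H = |f| ^ p` and `hardyNorm_rpow_le` gives (i); approximating indicators of closed sets
gives (iii), and the closed set `∂B` gives the final claim. -/

/-! ### Surface measure as cone volume; unitary invariance -/

open scoped Pointwise in
theorem exists_sphereMeasure_apply {d : ℕ} (hd : 1 ≤ d) :
    ∃ c : ℝ≥0∞, c ≠ 0 ∧ c ≠ ∞ ∧ ∀ s : Set (CSpace d), MeasurableSet s →
      sphereMeasure d s = c * volume (Set.Ioo (0 : ℝ) 1 • (s ∩ sphere (0 : CSpace d) 1)) := by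
  have : Nonempty (Fin d) := ⟨⟨0, hd⟩⟩
  have hfin : (Module.finrank ℝ (CSpace d) : ℝ≥0∞) ≠ 0 := by
    exact_mod_cast (Module.finrank_pos (R := ℝ) (M := CSpace d)).ne'
  refine ⟨((volume : Measure (CSpace d)).toSphere Set.univ)⁻¹ * Module.finrank ℝ (CSpace d),
    mul_ne_zero (ENNReal.inv_ne_zero.2 (measure_ne_top _ _)) hfin,
    ENNReal.mul_ne_top (ENNReal.inv_ne_top.2 (Measure.measure_univ_ne_zero.2
      (Measure.toSphere_ne_zero _))) (ENNReal.natCast_ne_top _), fun s hs => ?_⟩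
  · rw [sphereMeasure, Measure.smul_apply, Measure.map_apply measurable_subtype_coe hs,
      Measure.toSphere_apply' _ (measurable_subtype_coe hs), smul_eq_mul, mul_assoc,
      Subtype.image_preimage_coe, Set.inter_comm]

theorem isProbabilityMeasure_sphereMeasure {d : ℕ} (hd : 1 ≤ d) :
    IsProbabilityMeasure (sphereMeasure d) := by
  have : Nonempty (Fin d) := ⟨⟨0, hd⟩⟩
  refine ⟨?_⟩
  rw [sphereMeasure, Measure.smul_apply, Measure.map_apply measurable_subtype_coe .univ,
    Set.preimage_univ, smul_eq_mul, ENNReal.inv_mul_cancel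
      (Measure.measure_univ_ne_zero.2 (Measure.toSphere_ne_zero _)) (measure_ne_top _ _)]

theorem ae_mem_sphere_sphereMeasure (d : ℕ) :
    ∀ᵐ ζ ∂(sphereMeasure d), ζ ∈ sphere (0 : CSpace d) 1 := by
  refine Measure.ae_smul_measure ?_ _
  exact (ae_map_iff (p := (· ∈ sphere (0 : CSpace d) 1)) measurable_subtype_coe.aemeasurable
    isClosed_sphere.measurableSet).2 (.of_forall fun x => x.2)

-- The cone over the preimage of `s` is the preimage of the cone over `s`, and `U`, viewed as a real
-- isometry, preserves volume.
open scoped Pointwise in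
theorem measurePreserving_sphereMeasure {d : ℕ} (hd : 1 ≤ d) (U : CSpace d ≃ₗᵢ[ℂ] CSpace d) :
    MeasurePreserving U (sphereMeasure d) (sphereMeasure d) := by
  obtain ⟨c, -, -, hc⟩ := exists_sphereMeasure_apply hd
  refine ⟨U.continuous.measurable, Measure.ext fun s hs => ?_⟩
  let V : CSpace d ≃ₗᵢ[ℝ] CSpace d := ⟨U.toLinearEquiv.restrictScalars ℝ, U.norm_map⟩
  have hV : ∀ x, V x = U x := fun _ => rfl
  rw [Measure.map_apply U.continuous.measurable hs, hc _ (U.continuous.measurable hs), hc _ hs,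
    ← V.measurePreserving.measure_preimage_emb
      V.toHomeomorph.measurableEmbedding (Set.Ioo (0 : ℝ) 1 • (s ∩ sphere (0 : CSpace d) 1))]
  congr 2
  ext x
  simp only [Set.mem_smul, Set.mem_preimage, Set.mem_inter_iff, mem_sphere_zero_iff_norm]
  constructor
  · rintro ⟨t, ht, y, ⟨hy, hy1⟩, rfl⟩
    exact ⟨t, ht, U y, ⟨hy, by simpa using hy1⟩, by rw [map_smul]; rfl⟩
  · rintro ⟨t, ht, y, ⟨hy, hy1⟩, hxy⟩
    refine ⟨t, ht, U.symm y, ⟨by simpa using hy, by simpa using hy1⟩, V.injective ?_⟩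
    rw [← hxy, map_smul, hV, U.apply_symm_apply]

theorem exists_linearIsometryEquiv_apply_eq {d : ℕ} {u v : CSpace d} (hu : ‖u‖ = 1)
    (hv : ‖v‖ = 1) : ∃ U : CSpace d ≃ₗᵢ[ℂ] CSpace d, U u = v := by
  have hu0 : u ≠ 0 := by rintro rfl; simp at hu
  let e := LinearEquiv.toSpanNonzeroSingleton ℂ (CSpace d) u hu0
  let L : (ℂ ∙ u) →ₗᵢ[ℂ] CSpace d :=
    ⟨(LinearMap.toSpanSingleton ℂ (CSpace d) v).comp e.symm.toLinearMap, fun x => by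
      obtain ⟨c, rfl⟩ := e.surjective x
      rw [LinearMap.comp_apply, LinearEquiv.coe_coe, e.symm_apply_apply]
      simp [e, LinearMap.toSpanSingleton_apply, norm_smul, hu, hv]⟩
  refine ⟨L.extend.toLinearIsometryEquiv rfl, ?_⟩
  have h1 : L.extend u = L (e 1) := by
    rw [← LinearIsometry.extend_apply]
    simp [e]
  simp [h1, L]

/-- By uniqueness of Haar measure; it makes volumes of coordinate boxes computable as products. The
value of the constant plays no role. -/
theorem exists_volume_eq_smul_pi (d : ℕ) :
    ∃ c : ℝ≥0∞, c ≠ 0 ∧ c ≠ ∞ ∧ ∀ s : Set (CSpace d),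
      volume s = c * volume ((WithLp.toLp 2 : (Fin d → ℂ) → CSpace d) ⁻¹' s) := by
  let e := (PiLp.continuousLinearEquiv 2 ℝ (fun _ : Fin d => ℂ)).symm
  let ν : Measure (CSpace d) := Measure.map e volume
  have : ν.IsAddHaarMeasure := e.isAddHaarMeasure_map volume
  refine ⟨Measure.addHaarScalarFactor volume ν, ?_, ENNReal.coe_ne_top, fun s => ?_⟩
  · exact_mod_cast (Measure.addHaarScalarFactor_pos_of_isAddHaarMeasure volume ν).ne'
  · conv_lhs => rw [Measure.isAddLeftInvariant_eq_smul volume ν]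
    rw [Measure.smul_apply]
    change _ * Measure.map e.toHomeomorph volume s = _
    rw [e.toHomeomorph.measurableEmbedding.map_apply]
    rfl

theorem lintegral_comp_unitary {d : ℕ} (hd : 1 ≤ d) (U : CSpace d ≃ₗᵢ[ℂ] CSpace d)
    (f : CSpace d → ℝ≥0∞) :
    ∫⁻ ζ, f (U ζ) ∂(sphereMeasure d) = ∫⁻ ζ, f ζ ∂(sphereMeasure d) :=
  (measurePreserving_sphereMeasure hd U).lintegral_comp_emb
    U.toHomeomorph.measurableEmbedding f

/-! ### Size of nonisotropic balls -/

theorem isClosed_nonisoBall {d : ℕ} (ζ : CSpace d) (δ : ℝ) : IsClosed (nonisoBall ζ δ) :=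
  isClosed_sphere.inter (isClosed_le (f := fun ξ => ‖1 - inner ℂ ξ ζ‖) (by fun_prop)
    continuous_const)

theorem nonisoBall_subset_sphere {d : ℕ} (ζ : CSpace d) (δ : ℝ) :
    nonisoBall ζ δ ⊆ sphere (0 : CSpace d) 1 := fun _ h => h.1

theorem sphereMeasure_nonisoBall_congr {d : ℕ} (hd : 1 ≤ d) {u v : CSpace d} (hu : ‖u‖ = 1)
    (hv : ‖v‖ = 1) (δ : ℝ) :
    sphereMeasure d (nonisoBall u δ) = sphereMeasure d (nonisoBall v δ) := by
  obtain ⟨U, rfl⟩ := exists_linearIsometryEquiv_apply_eq hu hv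
  rw [← (measurePreserving_sphereMeasure hd U).measure_preimage
    (isClosed_nonisoBall (U u) δ).measurableSet.nullMeasurableSet]
  congr 1
  ext x
  simp [nonisoBall]

theorem Complex.volume_reProdIm (s t : Set ℝ) :
    volume (s ×ℂ t) = volume s * volume t := by
  rw [← Measure.prod_prod, ← Measure.volume_eq_prod,
    ← Complex.volume_preserving_equiv_real_prod.measure_preimage_equiv]
  rfl

theorem norm_one_sub_inner_single {n : ℕ} (ξ : CSpace (n + 1)) :
    ‖1 - inner ℂ ξ (EuclideanSpace.single 0 1 : CSpace (n + 1))‖ = ‖1 - ξ 0‖ := by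
  rw [EuclideanSpace.inner_single_right, one_mul, ← RCLike.norm_conj, map_sub]
  simp

/-- The product of a rectangle in the first coordinate and discs in the others. -/
def boxProd (n : ℕ) (A B : Set ℂ) : Set (Fin (n + 1) → ℂ) :=
  Set.univ.pi (Fin.cons A fun _ => B : Fin (n + 1) → Set ℂ)

theorem mem_boxProd {n : ℕ} {A B : Set ℂ} {z : Fin (n + 1) → ℂ} :
    z ∈ boxProd n A B ↔ z 0 ∈ A ∧ ∀ i : Fin n, z i.succ ∈ B := by
  simp [boxProd, Fin.forall_fin_succ]

theorem volume_boxProd (n : ℕ) (A B : Set ℂ) :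
    volume (boxProd n A B) = volume A * volume B ^ n := by
  simp [boxProd, volume_pi_pi, Fin.prod_univ_succ]

theorem normSq_eq_sum_succ {n : ℕ} (z : CSpace (n + 1)) :
    ‖z‖ ^ 2 = ‖z 0‖ ^ 2 + ∑ i : Fin n, ‖z i.succ‖ ^ 2 := by
  rw [EuclideanSpace.norm_sq_eq, Fin.sum_univ_succ]

-- From `|1 - ξ 0| ≤ δ`, the imaginary part of `ξ 0` is at most `δ` in modulus, and the other
-- coordinates satisfy `∑ |ξ i| ^ 2 = 1 - |ξ 0| ^ 2 ≤ 2 * δ`. The real part is left free. The box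
-- has volume of order `δ * δ ^ n`.
open scoped Pointwise in
theorem cone_nonisoBall_subset {n : ℕ} {δ : ℝ} (hδ : 0 < δ) :
    (WithLp.toLp 2 : (Fin (n + 1) → ℂ) → CSpace (n + 1)) ⁻¹'
      (Set.Ioo (0 : ℝ) 1 • (nonisoBall (EuclideanSpace.single 0 1) δ ∩ sphere 0 1)) ⊆
    boxProd n (Set.Icc (-1) 1 ×ℂ Set.Icc (-δ) δ) (closedBall 0 (√(2 * δ))) := by
  rintro z ⟨t, ⟨ht0, ht1⟩, ξ, ⟨⟨hξ, hξδ⟩, -⟩, hz⟩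
  have hz' : ∀ i, z i = t * ξ i := fun i => by
    have := congrArg (fun w : CSpace (n + 1) => w i) hz
    simpa using this.symm
  rw [norm_one_sub_inner_single] at hξδ
  rw [mem_sphere_zero_iff_norm] at hξ
  have h0 : ‖ξ 0‖ ≤ 1 := hξ ▸ PiLp.norm_apply_le ξ 0
  have hsum := normSq_eq_sum_succ ξ
  have h1 : 1 - δ ≤ ‖ξ 0‖ := by
    have := norm_sub_norm_le (1 : ℂ) (1 - ξ 0)
    simp only [norm_one, sub_sub_cancel] at this
    linarith
  rw [mem_boxProd]
  refine ⟨?_, fun i => ?_⟩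
  · rw [Complex.mem_reProdIm, hz']
    have hre := (Complex.abs_re_le_norm (ξ 0)).trans h0
    have him := (Complex.abs_im_le_norm (1 - ξ 0)).trans hξδ
    simp only [Complex.sub_im, Complex.one_im, zero_sub, abs_neg] at him
    rw [Complex.re_ofReal_mul, Complex.im_ofReal_mul, Set.mem_Icc, Set.mem_Icc, ← abs_le, ← abs_le,
      abs_mul, abs_mul, abs_of_pos ht0]
    exact ⟨by nlinarith [abs_nonneg (ξ 0).re], by nlinarith [abs_nonneg (ξ 0).im]⟩
  · rw [mem_closedBall_zero_iff, hz', norm_mul, Complex.norm_real, Real.norm_of_nonneg ht0.le]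
    have h2 : ‖ξ i.succ‖ ^ 2 ≤ 2 * δ := by
      have := Finset.single_le_sum (f := fun i : Fin n => ‖ξ i.succ‖ ^ 2)
        (fun _ _ => by positivity) (Finset.mem_univ i)
      simp only at this
      nlinarith [norm_nonneg (ξ 0)]
    calc t * ‖ξ i.succ‖ ≤ 1 * ‖ξ i.succ‖ := by gcongr
      _ ≤ _ := by rw [one_mul]; exact Real.le_sqrt_of_sq_le h2

-- A point `z` of the box lies on the ray through `z / ‖z‖`, so `|‖z‖ - z 0| ≤ δ * ‖z‖` is what is
-- needed. As `‖z‖ ≥ 1 / 4`, a bound `δ / 4` suffices; the constants give three errors `δ / 16`: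
-- from `‖z‖ - |z 0|`, from `|z 0| - re` and from `im`.
open scoped Pointwise in
theorem boxProd_subset_cone_nonisoBall {n : ℕ} {δ : ℝ} (hδ : 0 < δ) (hδ1 : δ ≤ 1) :
    boxProd n (Set.Icc (1 / 4) (1 / 2) ×ℂ Set.Icc 0 (δ / 16))
      (closedBall 0 (√(δ / (32 * (n + 1))))) ⊆
    (WithLp.toLp 2 : (Fin (n + 1) → ℂ) → CSpace (n + 1)) ⁻¹'
      (Set.Ioo (0 : ℝ) 1 • (nonisoBall (EuclideanSpace.single 0 1) δ ∩ sphere 0 1)) := by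
  intro x hx
  rw [mem_boxProd] at hx
  obtain ⟨hA, hB⟩ := hx
  rw [Complex.mem_reProdIm] at hA
  obtain ⟨⟨hr1, hr2⟩, hi1, hi2⟩ := hA
  set z : CSpace (n + 1) := WithLp.toLp 2 x with hz
  have hzi : ∀ i, z i = x i := fun _ => rfl
  have hsum := normSq_eq_sum_succ z
  have hS : ∑ i : Fin n, ‖z i.succ‖ ^ 2 ≤ δ / 32 := by
    calc ∑ i : Fin n, ‖z i.succ‖ ^ 2 ≤ ∑ _i : Fin n, δ / (32 * (n + 1)) := by
          refine Finset.sum_le_sum fun i _ => ?_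
          have := mem_closedBall_zero_iff.1 (hB i)
          rw [hzi]
          exact (Real.le_sqrt (norm_nonneg _) (by positivity)).1 this
      _ = n * (δ / (32 * (n + 1))) := by simp
      _ ≤ (n + 1) * (δ / (32 * (n + 1))) := by gcongr; linarith
      _ = δ / 32 := by field_simp
  have hS0 : 0 ≤ ∑ i : Fin n, ‖z i.succ‖ ^ 2 := Finset.sum_nonneg fun _ _ => by positivity
  have hz0 : ‖z 0‖ ^ 2 = (x 0).re ^ 2 + (x 0).im ^ 2 := by
    rw [hzi, Complex.sq_norm, Complex.normSq_apply]; ring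
  have hlow : 1 / 4 ≤ ‖z 0‖ := hr1.trans ((le_abs_self _).trans (Complex.abs_re_le_norm (x 0)))
  have hle : ‖z 0‖ ≤ ‖z‖ := PiLp.norm_apply_le z 0
  have hz1 : ‖z‖ < 1 := by nlinarith [norm_nonneg z]
  have hzpos : 0 < ‖z‖ := by linarith
  have hd1 : ‖z‖ - ‖z 0‖ ≤ δ / 16 := by nlinarith
  have hd2 : ‖z 0‖ ≤ (x 0).re + (x 0).im := by
    have := Complex.norm_le_abs_re_add_abs_im (x 0)
    rwa [abs_of_nonneg (by linarith), abs_of_nonneg hi1] at this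
  have hd3 : ‖(‖z‖ : ℂ) - z 0‖ ≤ δ / 4 := by
    have := Complex.norm_le_abs_re_add_abs_im ((‖z‖ : ℂ) - z 0)
    have hre : (x 0).re ≤ ‖z 0‖ := (le_abs_self _).trans (Complex.abs_re_le_norm (x 0))
    simp only [Complex.sub_re, Complex.ofReal_re, Complex.sub_im, Complex.ofReal_im, hzi,
      zero_sub, abs_neg] at this
    rw [abs_of_nonneg hi1, abs_of_nonneg (by linarith)] at this
    rw [hzi]
    linarith
  have hunit : ‖(‖z‖⁻¹ : ℝ) • z‖ = 1 := by
    rw [norm_smul, norm_inv, norm_norm, inv_mul_cancel₀ hzpos.ne']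
  refine ⟨‖z‖, ⟨hzpos, hz1⟩, ‖z‖⁻¹ • z, ⟨⟨by simpa using hunit, ?_⟩, by simpa using hunit⟩, ?_⟩
  · rw [norm_one_sub_inner_single]
    have : (1 : ℂ) - (‖z‖⁻¹ • z) 0 = (‖z‖ : ℂ)⁻¹ * ((‖z‖ : ℂ) - z 0) := by
      have : (‖z‖ : ℂ) ≠ 0 := by exact_mod_cast hzpos.ne'
      rw [PiLp.smul_apply, Complex.real_smul, mul_sub, inv_mul_cancel₀ this]
      simp
    rw [this, norm_mul, norm_inv, Complex.norm_real, norm_norm, inv_mul_le_iff₀ hzpos]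
    nlinarith
  · change ‖z‖ • ‖z‖⁻¹ • z = z
    rw [smul_smul, mul_inv_cancel₀ hzpos.ne', one_smul]

theorem exists_sphereMeasure_nonisoBall_le {d : ℕ} (hd : 1 ≤ d) :
    ∃ A : ℝ≥0∞, A ≠ ∞ ∧ ∀ ζ : CSpace d, ‖ζ‖ = 1 → ∀ δ : ℝ, 0 < δ →
      sphereMeasure d (nonisoBall ζ δ) ≤ A * ENNReal.ofReal δ ^ d := by
  obtain ⟨c, -, hc, hcσ⟩ := exists_sphereMeasure_apply hd
  obtain ⟨κ, -, hκ, hκv⟩ := exists_volume_eq_smul_pi d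
  obtain ⟨n, rfl⟩ : ∃ n, d = n + 1 := ⟨d - 1, by omega⟩
  refine ⟨c * (κ * (ENNReal.ofReal 4 * (ENNReal.ofReal 2 * NNReal.pi) ^ n)), by finiteness,
    fun ζ hζ δ hδ => ?_⟩
  rw [sphereMeasure_nonisoBall_congr hd hζ (v := EuclideanSpace.single 0 1) (by simp),
    hcσ _ (isClosed_nonisoBall _ _).measurableSet, hκv]
  refine (mul_le_mul_right (mul_le_mul_right (measure_mono (cone_nonisoBall_subset hδ)) κ) c).trans
    (le_of_eq ?_)
  rw [volume_boxProd, Complex.volume_reProdIm, Complex.volume_closedBall, Real.volume_Icc,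
    Real.volume_Icc, ← ENNReal.ofReal_pow (by positivity), Real.sq_sqrt (by positivity),
    ENNReal.ofReal_mul (by norm_num), show δ - -δ = 2 * δ by ring,
    ENNReal.ofReal_mul (by norm_num), show (4 : ℝ) = 2 * 2 by norm_num,
    ENNReal.ofReal_mul (by norm_num), show (1 : ℝ) - -1 = 2 by norm_num]
  ring

theorem exists_le_sphereMeasure_nonisoBall {d : ℕ} (hd : 1 ≤ d) :
    ∃ a : ℝ≥0∞, a ≠ 0 ∧ a ≠ ∞ ∧ ∀ ζ : CSpace d, ‖ζ‖ = 1 → ∀ δ : ℝ, 0 < δ → δ ≤ 1 →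
      a * ENNReal.ofReal δ ^ d ≤ sphereMeasure d (nonisoBall ζ δ) := by
  obtain ⟨c, hc0, hc, hcσ⟩ := exists_sphereMeasure_apply hd
  obtain ⟨κ, hκ0, hκ, hκv⟩ := exists_volume_eq_smul_pi d
  obtain ⟨n, rfl⟩ : ∃ n, d = n + 1 := ⟨d - 1, by omega⟩
  refine ⟨c * (κ * (ENNReal.ofReal (1 / 64) *
    (ENNReal.ofReal (1 / (32 * (n + 1))) * NNReal.pi) ^ n)), ?_, by finiteness,
    fun ζ hζ δ hδ hδ1 => ?_⟩
  · have h1 : ENNReal.ofReal (1 / 64) ≠ 0 := by simp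
    have h2 : ENNReal.ofReal (1 / (32 * (n + 1))) ≠ 0 := by
      rw [ne_eq, ENNReal.ofReal_eq_zero, not_le]; positivity
    have h3 : (NNReal.pi : ℝ≥0∞) ≠ 0 := by exact_mod_cast NNReal.pi_ne_zero
    positivity
  rw [sphereMeasure_nonisoBall_congr hd hζ (v := EuclideanSpace.single 0 1) (by simp),
    hcσ _ (isClosed_nonisoBall _ _).measurableSet, hκv]
  refine (le_of_eq ?_).trans (mul_le_mul_right (mul_le_mul_right
    (measure_mono (boxProd_subset_cone_nonisoBall hδ hδ1)) κ) c)
  rw [volume_boxProd, Complex.volume_reProdIm, Complex.volume_closedBall, Real.volume_Icc,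
    Real.volume_Icc, ← ENNReal.ofReal_pow (Real.sqrt_nonneg _), Real.sq_sqrt (by positivity),
    ← ENNReal.ofReal_mul (by norm_num), show (1 / 2 - 1 / 4) * (δ / 16 - 0) = 1 / 64 * δ by ring,
    ENNReal.ofReal_mul (by norm_num), show δ / (32 * (n + 1)) = 1 / (32 * (n + 1)) * δ by ring,
    ENNReal.ofReal_mul (by positivity)]
  ring

/-! ### The Hardy norm is dominated by the boundary integral -/

/-- Evaluation at a point of the disc is represented by a probability measure on the circle. -/
theorem exists_poisson_measure {r : ℝ} (hr0 : 0 < r) (hr1 : r < 1) :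
    ∃ ν : Measure ℝ, IsProbabilityMeasure ν ∧ ∀ g : ℂ → ℂ, DiffContOnCl ℂ g (ball 0 1) →
      g r = ∫ θ, g (circleMap 0 1 θ) ∂ν := by
  have hr : (r : ℂ) ∈ ball (0 : ℂ) 1 := by
    rw [mem_ball_zero_iff, Complex.norm_real, Real.norm_of_nonneg hr0.le]; exact hr1
  let P : ℝ → ℝ := fun θ => (2 * Real.pi)⁻¹ * poissonKernel 0 r (circleMap 0 1 θ)
  have hP0 : ∀ θ, 0 ≤ P θ := fun θ => by
    have : 0 ≤ (1 : ℝ) - r ^ 2 := by nlinarith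
    simp only [P, poissonKernel_def, sub_zero, norm_circleMap_zero, Complex.norm_real,
      Real.norm_eq_abs, sq_abs]
    rw [one_pow]
    positivity
  have hPm : Measurable P := by
    simp only [P, poissonKernel_def]
    have : Measurable (circleMap 0 1) := (continuous_circleMap 0 1).measurable
    fun_prop
  let ν : Measure ℝ := (volume.restrict (Set.Ioc 0 (2 * Real.pi))).withDensity
    fun θ => ENNReal.ofReal (P θ)
  have key : ∀ g : ℂ → ℂ, DiffContOnCl ℂ g (ball 0 1) →
      g r = ∫ θ, g (circleMap 0 1 θ) ∂ν := fun g hg => by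
    rw [← hg.circleAverage_poissonKernel_smul hr, Real.circleAverage_def,
      intervalIntegral.integral_of_le Real.two_pi_pos.le,
      integral_withDensity_eq_integral_toReal_smul₀ (by fun_prop) (by simp), ← integral_smul]
    refine integral_congr_ae (.of_forall fun θ => ?_)
    simp only [Pi.smul_apply', ENNReal.toReal_ofReal (hP0 θ), smul_smul, P]
  refine ⟨ν, ⟨?_⟩, key⟩
  -- Reproducing the constant `1` forces total mass one.
  have h1 := key (fun _ => 1) ⟨differentiableOn_const _, continuousOn_const⟩
  simp only [integral_const, Complex.real_smul, mul_one, Measure.real] at h1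
  have h2 : (ν Set.univ).toReal = 1 := by exact_mod_cast h1.symm
  rwa [ENNReal.toReal_eq_one_iff] at h2

/-- Apply the representation to the slice `c ↦ f (c • ζ)`; then monotonicity of `L^p` means for a
probability measure replaces Jensen. -/
theorem enorm_rpow_le_lintegral_slice {d : ℕ} {p : ℝ} (hp : 1 < p) {ν : Measure ℝ}
    [IsProbabilityMeasure ν] {r : ℝ}
    (hν : ∀ g : ℂ → ℂ, DiffContOnCl ℂ g (ball 0 1) → g r = ∫ θ, g (circleMap 0 1 θ) ∂ν)
    {f : CSpace d → ℂ} (hf : DifferentiableOn ℂ f (ball 0 1))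
    (hc : ContinuousOn f (closedBall 0 1)) {ζ : CSpace d} (hζ : ‖ζ‖ = 1) :
    ‖f (r • ζ)‖ₑ ^ p ≤ ∫⁻ θ, ‖f (circleMap 0 1 θ • ζ)‖ₑ ^ p ∂ν := by
  have hcl : closure (ball (0 : ℂ) 1) = closedBall 0 1 := closure_ball _ one_ne_zero
  have hg : DiffContOnCl ℂ (fun c : ℂ => f (c • ζ)) (ball 0 1) := by
    refine ⟨hf.comp (by fun_prop) fun c hc => ?_, ?_⟩
    · rw [mem_ball_zero_iff] at hc ⊢; rwa [norm_smul, hζ, mul_one]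
    · rw [hcl]
      refine hc.comp (by fun_prop) fun c hc => ?_
      rw [mem_closedBall_zero_iff] at hc ⊢; rwa [norm_smul, hζ, mul_one]
  have hcont : Continuous fun θ : ℝ => f (circleMap 0 1 θ • ζ) := by
    refine continuousOn_univ.1
      (hc.comp (by fun_prop : Continuous fun θ : ℝ => circleMap 0 1 θ • ζ).continuousOn
        fun θ _ => ?_)
    rw [mem_closedBall_zero_iff, norm_smul, hζ, norm_circleMap_zero, abs_one, mul_one]
  have hr := hν _ hg
  have hrs : f (r • ζ) = ∫ θ, f (circleMap 0 1 θ • ζ) ∂ν := by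
    rw [← hr, Complex.coe_smul]
  have hp0 : 0 < p := by linarith
  rw [hrs, lintegral_rpow_enorm_eq_rpow_eLpNorm' hp0]
  refine ENNReal.rpow_le_rpow (((enorm_integral_le_lintegral_enorm _).trans_eq ?_).trans
    (eLpNorm'_le_eLpNorm'_of_exponent_le one_pos hp.le ν hcont.aestronglyMeasurable)) hp0.le
  simp [eLpNorm'_eq_lintegral_enorm]

theorem lintegral_circle_smul {d : ℕ} (hd : 1 ≤ d) (F : CSpace d → ℝ≥0∞) (θ : ℝ) :
    ∫⁻ ζ, F (circleMap 0 1 θ • ζ) ∂(sphereMeasure d) = ∫⁻ ζ, F ζ ∂(sphereMeasure d) := by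
  let u : unitary ℂ := ⟨circleMap 0 1 θ, by
    rw [Unitary.mem_iff, mul_comm _ (star _), and_self, Complex.star_def, Complex.conj_mul',
      norm_circleMap_zero]
    simp⟩
  exact lintegral_comp_unitary hd (u • LinearIsometryEquiv.refl ℂ (CSpace d)) F

theorem measurable_indicator_of_continuousOn {X Y : Type*} [TopologicalSpace X]
    [MeasurableSpace X] [BorelSpace X] [TopologicalSpace Y] [MeasurableSpace Y] [BorelSpace Y]
    [Zero Y] {s : Set X} (hs : MeasurableSet s) {f : X → Y} (hf : ContinuousOn f s) :
    Measurable (s.indicator f) := by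
  classical
  rw [← Set.piecewise_eq_indicator]
  exact hf.measurable_piecewise continuousOn_const hs

/-- Integrate the slice inequality over the sphere and exchange the integrals: for each fixed `θ`
the rotation by `e^{iθ}` preserves `σ`, so the average over `θ` disappears. -/
theorem lintegral_dilation_le {d : ℕ} (hd : 1 ≤ d) {p : ℝ} (hp : 1 < p) {f : CSpace d → ℂ}
    (hf : DifferentiableOn ℂ f (ball 0 1)) (hc : ContinuousOn f (closedBall 0 1)) {r : ℝ}
    (hr0 : 0 < r) (hr1 : r < 1) :
    ∫⁻ ζ, ‖f (r • ζ)‖ₑ ^ p ∂(sphereMeasure d) ≤ ∫⁻ ζ, ‖f ζ‖ₑ ^ p ∂(sphereMeasure d) := by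
  have := isProbabilityMeasure_sphereMeasure hd
  obtain ⟨ν, _, hν⟩ := exists_poisson_measure hr0 hr1
  -- `f` is controlled only on the closed ball; cutting off to the sphere gives a globally
  -- measurable function, as Tonelli requires.
  let F : CSpace d → ℝ≥0∞ := (sphere 0 1).indicator fun ζ => ‖f ζ‖ₑ ^ p
  have hF : Measurable F := measurable_indicator_of_continuousOn isClosed_sphere.measurableSet
    ((ENNReal.continuous_rpow_const.comp continuous_enorm).comp_continuousOn
      (hc.mono sphere_subset_closedBall))
  have hFeq : ∀ ζ ∈ sphere (0 : CSpace d) 1, F ζ = ‖f ζ‖ₑ ^ p := fun ζ h =>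
    Set.indicator_of_mem h _
  calc ∫⁻ ζ, ‖f (r • ζ)‖ₑ ^ p ∂(sphereMeasure d)
      ≤ ∫⁻ ζ, ∫⁻ θ, F (circleMap 0 1 θ • ζ) ∂ν ∂(sphereMeasure d) := by
        refine lintegral_mono_ae ?_
        filter_upwards [ae_mem_sphere_sphereMeasure d] with ζ hζ
        have hζ1 : ‖ζ‖ = 1 := mem_sphere_zero_iff_norm.1 hζ
        refine (enorm_rpow_le_lintegral_slice hp hν hf hc hζ1).trans_eq ?_
        refine lintegral_congr fun θ => (hFeq _ ?_).symm
        rw [mem_sphere_zero_iff_norm, norm_smul, hζ1, norm_circleMap_zero]; simp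
    _ = ∫⁻ θ, ∫⁻ ζ, F (circleMap 0 1 θ • ζ) ∂(sphereMeasure d) ∂ν := by
        refine lintegral_lintegral_swap (Measurable.aemeasurable ?_)
        refine hF.comp ?_
        have : Measurable (circleMap 0 1) := (continuous_circleMap 0 1).measurable
        fun_prop
    _ = ∫⁻ ζ, F ζ ∂(sphereMeasure d) := by simp [lintegral_circle_smul hd]
    _ = ∫⁻ ζ, ‖f ζ‖ₑ ^ p ∂(sphereMeasure d) := by
        refine lintegral_congr_ae ?_
        filter_upwards [ae_mem_sphere_sphereMeasure d] with ζ hζ using hFeq ζ hζ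

theorem hardyNorm_rpow {d : ℕ} {p : ℝ} (hp : 0 < p) (f : CSpace d → ℂ) :
    hardyNorm p f ^ p =
      ⨆ r ∈ Set.Ioo (0 : ℝ) 1, ∫⁻ ζ, ‖f (r • ζ)‖ₑ ^ p ∂(sphereMeasure d) := by
  rw [hardyNorm, ← ENNReal.rpow_mul, one_div_mul_cancel hp.ne', ENNReal.rpow_one]

theorem hardyNorm_rpow_le {d : ℕ} (hd : 1 ≤ d) {p : ℝ} (hp : 1 < p) {f : CSpace d → ℂ}
    (hf : DifferentiableOn ℂ f (ball 0 1)) (hc : ContinuousOn f (closedBall 0 1)) :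
    hardyNorm p f ^ p ≤ ∫⁻ ζ, ‖f ζ‖ₑ ^ p ∂(sphereMeasure d) := by
  rw [hardyNorm_rpow (by linarith)]
  exact iSup₂_le fun r hr => lintegral_dilation_le hd hp hf hc hr.1 hr.2

/-! ### The Cauchy kernel: symmetry and pointwise estimates -/

open Filter Topology

theorem norm_cauchyKernel {d : ℕ} (w z : CSpace d) :
    ‖cauchyKernel w z‖ = (‖1 - inner ℂ w z‖ ^ d)⁻¹ := by
  rw [cauchyKernel, norm_div, norm_one, norm_pow, one_div]

theorem norm_one_sub_inner_comm {d : ℕ} (w z : CSpace d) :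
    ‖1 - inner ℂ w z‖ = ‖1 - inner ℂ z w‖ := by
  rw [← inner_conj_symm w z, ← RCLike.norm_conj]
  simp

theorem enorm_cauchyKernel_comm {d : ℕ} (w z : CSpace d) :
    ‖cauchyKernel w z‖ₑ = ‖cauchyKernel z w‖ₑ := by
  rw [← ofReal_norm, ← ofReal_norm, norm_cauchyKernel, norm_cauchyKernel,
    norm_one_sub_inner_comm]

theorem inner_realSmul_left {d : ℕ} (r : ℝ) (w z : CSpace d) :
    inner ℂ (r • w) z = r * inner ℂ w z := by
  rw [← Complex.coe_smul, inner_smul_left, Complex.conj_ofReal]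

theorem cauchyKernel_smul_left {d : ℕ} (r : ℝ) (w z : CSpace d) :
    cauchyKernel (r • w) z = cauchyKernel w (r • z) := by
  rw [cauchyKernel, cauchyKernel, inner_realSmul_left, ← Complex.coe_smul, inner_smul_right]

theorem cauchyKernel_map_map {d : ℕ} (U : CSpace d ≃ₗᵢ[ℂ] CSpace d) (w z : CSpace d) :
    cauchyKernel (U w) (U z) = cauchyKernel w z := by
  rw [cauchyKernel, cauchyKernel, U.inner_map_map]

theorem enorm_cauchyKernel_rpow {d : ℕ} {p : ℝ} (hp : 0 < p) {w z : CSpace d}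
    (h : 0 < ‖1 - inner ℂ w z‖) :
    ‖cauchyKernel w z‖ₑ ^ p = ENNReal.ofReal (‖1 - inner ℂ w z‖ ^ (-(d * p))) := by
  rw [← ofReal_norm, ENNReal.ofReal_rpow_of_nonneg (norm_nonneg _) hp.le,
    norm_cauchyKernel, Real.rpow_neg h.le, Real.inv_rpow (by positivity), Real.rpow_mul h.le,
    Real.rpow_natCast]

theorem enorm_cauchyKernel_rpow_le {d : ℕ} {p : ℝ} (hp : 0 < p) {w z : CSpace d} {a : ℝ}
    (ha : 0 < a) (h : a ≤ ‖1 - inner ℂ w z‖) :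
    ‖cauchyKernel w z‖ₑ ^ p ≤ ENNReal.ofReal (a ^ (-(d * p))) := by
  rw [enorm_cauchyKernel_rpow hp (ha.trans_le h)]
  exact ENNReal.ofReal_le_ofReal
    (Real.rpow_le_rpow_of_nonpos ha h (by simp only [Left.neg_nonpos_iff]; positivity))

theorem one_sub_norm_mul_norm_le {d : ℕ} (w z : CSpace d) :
    1 - ‖w‖ * ‖z‖ ≤ ‖1 - inner ℂ w z‖ := by
  have h1 := norm_sub_norm_le (1 : ℂ) (inner ℂ w z)
  have h2 := norm_inner_le_norm (𝕜 := ℂ) w z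
  rw [norm_one] at h1
  linarith

theorem one_sub_inner_pos {d : ℕ} {w z : CSpace d} (hw : ‖w‖ < 1) (hz : ‖z‖ ≤ 1) :
    0 < ‖1 - inner ℂ w z‖ :=
  lt_of_lt_of_le (by nlinarith [norm_nonneg w, norm_nonneg z]) (one_sub_norm_mul_norm_le w z)

theorem continuousAt_cauchyKernel {d : ℕ} {w z : CSpace d} (hw : ‖w‖ < 1) (hz : ‖z‖ ≤ 1) :
    ContinuousAt (cauchyKernel w) z := by
  have : (1 - inner ℂ w z) ^ d ≠ 0 := pow_ne_zero _ (norm_pos_iff.1 (one_sub_inner_pos hw hz))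
  exact ContinuousAt.div (by fun_prop) (by fun_prop) this

theorem differentiableOn_cauchyKernel {d : ℕ} {w : CSpace d} (hw : ‖w‖ < 1) :
    DifferentiableOn ℂ (cauchyKernel w) (ball 0 1) := by
  intro z hz
  have : (1 - inner ℂ w z) ^ d ≠ 0 :=
    pow_ne_zero _ (norm_pos_iff.1 (one_sub_inner_pos hw (mem_ball_zero_iff.1 hz).le))
  have h1 : Differentiable ℂ fun z : CSpace d => inner ℂ w z := (innerSL ℂ w).differentiable
  have h2 : Differentiable ℂ fun z : CSpace d => (1 - inner ℂ w z) ^ d := by fun_prop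
  have h3 : DifferentiableAt ℂ (fun z : CSpace d => ((1 - inner ℂ w z) ^ d)⁻¹) z :=
    h2.differentiableAt.fun_inv this
  exact h3.differentiableWithinAt.congr_of_eventuallyEq
    (.of_forall fun _ => one_div _) (one_div _)

theorem measurable_cauchyKernel_comp {X : Type*} [MeasurableSpace X] {d : ℕ}
    {f g : X → CSpace d} (hf : Measurable f) (hg : Measurable g) :
    Measurable fun x => cauchyKernel (f x) (g x) := by
  have h : Measurable fun x => (inner ℂ (f x) (g x) : ℂ) := hf.inner hg
  have h1 : Measurable fun x => (1 - inner ℂ (f x) (g x) : ℂ) ^ d := (h.const_sub 1).pow_const d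
  exact h1.const_div 1

/-- In `1 - c = (1 - r * c) - (1 - r) * c` both terms are bounded by `‖1 - r * c‖`. This moves a
pole `r • ζ` out to `ζ` at the cost of a factor `2`. -/
theorem norm_one_sub_le_two_mul {c : ℂ} {r : ℝ} (hc : ‖c‖ ≤ 1) (hr0 : 0 ≤ r) (hr1 : r ≤ 1) :
    ‖1 - c‖ ≤ 2 * ‖1 - r * c‖ := by
  have h1 : 1 - r ≤ ‖1 - r * c‖ := by
    have := norm_sub_norm_le (1 : ℂ) (r * c)
    rw [norm_one, norm_mul, Complex.norm_real, Real.norm_of_nonneg hr0] at this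
    nlinarith
  have h2 : 1 - c = (1 - r * c) - ((1 - r : ℝ) : ℂ) * c := by push_cast; ring
  have h3 : ‖((1 - r : ℝ) : ℂ) * c‖ ≤ 1 - r := by
    rw [norm_mul, Complex.norm_real, Real.norm_of_nonneg (by linarith)]
    nlinarith
  have := norm_sub_le (1 - r * c) (((1 - r : ℝ) : ℂ) * c)
  rw [h2]
  linarith

theorem norm_one_sub_mul_le {c : ℂ} {r : ℝ} (hr0 : 0 ≤ r) (hr1 : r ≤ 1)
    (hc : ‖1 - c‖ ≤ 1 - r) : ‖1 - r * c‖ ≤ 2 * (1 - r) := by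
  have h2 : 1 - r * c = ((1 - r : ℝ) : ℂ) + r * (1 - c) := by push_cast; ring
  rw [h2]
  refine (norm_add_le _ _).trans ?_
  rw [norm_mul, Complex.norm_real, Complex.norm_real, Real.norm_of_nonneg hr0,
    Real.norm_of_nonneg (by linarith)]
  nlinarith [norm_nonneg (1 - c)]

/-! ### Growth of the Hardy norm of the Cauchy kernel -/

/-- The `p`-th power of the `L^p(σ)` norm of the Cauchy kernel. -/
noncomputable def kernelIntegral {d : ℕ} (p : ℝ) (w : CSpace d) : ℝ≥0∞ :=
  ∫⁻ ζ, ‖cauchyKernel w ζ‖ₑ ^ p ∂(sphereMeasure d)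

theorem kernelIntegral_smul_congr {d : ℕ} (hd : 1 ≤ d) (p r : ℝ) {u v : CSpace d} (hu : ‖u‖ = 1)
    (hv : ‖v‖ = 1) : kernelIntegral p (r • u) = kernelIntegral p (r • v) := by
  obtain ⟨U, rfl⟩ := exists_linearIsometryEquiv_apply_eq hu hv
  rw [kernelIntegral, kernelIntegral]
  conv_rhs => rw [← lintegral_comp_unitary hd U]
  refine lintegral_congr fun ζ => ?_
  rw [cauchyKernel_smul_left, cauchyKernel_smul_left, ← Complex.coe_smul r ζ,
    ← Complex.coe_smul r (U ζ), ← map_smul, cauchyKernel_map_map]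

theorem lintegral_cauchyKernel_swap {d : ℕ} (p r : ℝ) (z : CSpace d) :
    ∫⁻ ζ, ‖cauchyKernel (r • ζ) z‖ₑ ^ p ∂(sphereMeasure d) = kernelIntegral p (r • z) :=
  lintegral_congr fun ζ => by rw [enorm_cauchyKernel_comm, cauchyKernel_smul_left]

theorem hardyNorm_cauchyKernel_rpow {d : ℕ} {p : ℝ} (hp : 0 < p) (w : CSpace d) :
    hardyNorm p (cauchyKernel w) ^ p = ⨆ r ∈ Set.Ioo (0 : ℝ) 1, kernelIntegral p (r • w) := by
  simp only [hardyNorm_rpow hp, kernelIntegral, cauchyKernel_smul_left]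

theorem hardyNorm_cauchyKernel_congr {d : ℕ} (hd : 1 ≤ d) {p : ℝ} (hp : 0 < p) (r : ℝ)
    {u v : CSpace d} (hu : ‖u‖ = 1) (hv : ‖v‖ = 1) :
    hardyNorm p (cauchyKernel (r • u)) ^ p = hardyNorm p (cauchyKernel (r • v)) ^ p := by
  simp only [hardyNorm_cauchyKernel_rpow hp, smul_smul, kernelIntegral_smul_congr hd p _ hu hv]

/-- The supremum in the Hardy norm omits the radii `0` and `1`; Fatou's lemma and continuity of the
kernel on the closed ball recover them. -/
theorem kernelIntegral_smul_le_hardyNorm {d : ℕ} {p : ℝ} (hp : 0 < p) {w : CSpace d}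
    (hw : ‖w‖ < 1) {r : ℝ} (hr : r ∈ Set.Icc (0 : ℝ) 1) :
    kernelIntegral p (r • w) ≤ hardyNorm p (cauchyKernel w) ^ p := by
  have : (𝓝[Set.Ioo (0 : ℝ) 1] r).NeBot := by
    rw [← mem_closure_iff_nhdsWithin_neBot, closure_Ioo zero_ne_one]; exact hr
  calc kernelIntegral p (r • w)
      ≤ ∫⁻ ζ, liminf (fun ρ : ℝ => ‖cauchyKernel w (ρ • ζ)‖ₑ ^ p) (𝓝[Set.Ioo (0 : ℝ) 1] r)
          ∂(sphereMeasure d) := by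
        refine lintegral_mono_ae ?_
        filter_upwards [ae_mem_sphere_sphereMeasure d] with ζ hζ
        rw [mem_sphere_zero_iff_norm] at hζ
        refine le_of_eq (Tendsto.liminf_eq ?_).symm
        rw [cauchyKernel_smul_left]
        have h1 : ContinuousAt (cauchyKernel w) (r • ζ) := continuousAt_cauchyKernel hw (by
          rw [norm_smul, hζ, mul_one, Real.norm_of_nonneg hr.1]; exact hr.2)
        have h2 : Tendsto (fun ρ : ℝ => ρ • ζ) (𝓝 r) (𝓝 (r • ζ)) :=
          (by fun_prop : Continuous fun ρ : ℝ => ρ • ζ).tendsto r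
        exact ((ENNReal.continuous_rpow_const.comp continuous_enorm).continuousAt.tendsto.comp
          (h1.tendsto.comp h2)).mono_left nhdsWithin_le_nhds
    _ ≤ liminf (fun ρ : ℝ => ∫⁻ ζ, ‖cauchyKernel w (ρ • ζ)‖ₑ ^ p ∂(sphereMeasure d))
          (𝓝[Set.Ioo (0 : ℝ) 1] r) :=
        lintegral_liminf_le fun ρ => ((measurable_cauchyKernel_comp measurable_const
          (measurable_const_smul ρ)).enorm.pow_const p)
    _ ≤ hardyNorm p (cauchyKernel w) ^ p := by
        rw [hardyNorm_rpow hp]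
        refine liminf_le_of_frequently_le' (Eventually.frequently ?_)
        filter_upwards [self_mem_nhdsWithin] with ρ hρ
        exact le_iSup₂ (f := fun ρ (_ : ρ ∈ Set.Ioo (0 : ℝ) 1) =>
          ∫⁻ ζ, ‖cauchyKernel w (ρ • ζ)‖ₑ ^ p ∂(sphereMeasure d)) ρ hρ

theorem kernelIntegral_zero {d : ℕ} (hd : 1 ≤ d) (p : ℝ) :
    kernelIntegral p (0 : CSpace d) = 1 := by
  have := isProbabilityMeasure_sphereMeasure hd
  simp [kernelIntegral, cauchyKernel]

theorem one_le_hardyNorm_cauchyKernel {d : ℕ} (hd : 1 ≤ d) {p : ℝ} (hp : 0 < p) {w : CSpace d}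
    (hw : ‖w‖ < 1) : 1 ≤ hardyNorm p (cauchyKernel w) ^ p := by
  have := kernelIntegral_smul_le_hardyNorm hp hw (r := 0) ⟨le_rfl, zero_le_one⟩
  rwa [zero_smul, kernelIntegral_zero hd] at this

theorem lintegral_rpow_Ioo {p T : ℝ} (hp : 1 < p) (hT : 0 < T) :
    ∫⁻ t in Set.Ioo 0 T, ENNReal.ofReal (t ^ (-(1 / p))) =
      ENNReal.ofReal (T ^ (1 - 1 / p) / (1 - 1 / p)) := by
  have h1 : 1 / p < 1 := by rw [div_lt_one (by linarith)]; exact hp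
  rw [← ofReal_integral_eq_lintegral_ofReal, ← integral_Ioc_eq_integral_Ioo,
    ← intervalIntegral.integral_of_le hT.le, integral_rpow (Or.inl (by linarith)),
    Real.zero_rpow (by linarith), sub_zero]
  · rw [neg_add_eq_sub]
  · rw [← IntegrableOn, ← integrableOn_Ioc_iff_integrableOn_Ioo, 
      ← intervalIntegrable_iff_integrableOn_Ioc_of_le hT.le]
    exact intervalIntegral.intervalIntegrable_rpow' (by linarith)
  · filter_upwards [ae_restrict_mem measurableSet_Ioo] with t ht
    exact Real.rpow_nonneg ht.1.le _

/-- Layer cake: with `s = d * p`, the level set at `t` lies in `Q(ζ, 2 t^{-1/s})` up to a null set,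
so its measure is `O(t^{-1/p})`, and it is null once `t ≥ T = (1 - r)^{-s}`. Since `p > 1`, the
integral of `t^{-1/p}` over `(0, T)` converges and is of order `T^{1-1/p} = (1 - r)^{d-dp}`. -/
theorem exists_kernelIntegral_le {d : ℕ} (hd : 1 ≤ d) {p : ℝ} (hp : 1 < p) :
    ∃ A : ℝ≥0∞, A ≠ 0 ∧ A ≠ ∞ ∧ ∀ ζ : CSpace d, ‖ζ‖ = 1 → ∀ r : ℝ, 0 ≤ r → r < 1 →
      kernelIntegral p (r • ζ) ≤ A * ENNReal.ofReal ((1 - r) ^ (d - d * p)) := by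
  obtain ⟨A, hA, hAσ⟩ := exists_sphereMeasure_nonisoBall_le hd
  have hp0 : 0 < p := by linarith
  have hd0 : (0 : ℝ) < d := by exact_mod_cast hd
  have h1p : 0 < 1 - 1 / p := by
    rw [sub_pos, div_lt_one (by linarith)]; exact hp
  -- `A + 1` rather than `A`: the constant must be nonzero, since it is divided by later.
  refine ⟨(A + 1) * (ENNReal.ofReal (2 ^ d) * ENNReal.ofReal (1 / (1 - 1 / p))), ?_,
    by finiteness, fun ζ hζ r hr0 hr1 => ?_⟩
  · have h2 : ENNReal.ofReal (2 ^ d) ≠ 0 := by simp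
    have h3 : ENNReal.ofReal (1 / (1 - 1 / p)) ≠ 0 := by
      rw [ne_eq, ENNReal.ofReal_eq_zero, not_le]; positivity
    exact mul_ne_zero (by simp) (mul_ne_zero h2 h3)
  have hδ : 0 < 1 - r := by linarith
  set s : ℝ := d * p with hs
  have hs0 : 0 < s := by positivity
  set T : ℝ := (1 - r) ^ (-s) with hT
  have hT0 : 0 < T := by positivity
  let F : CSpace d → ℝ := fun ξ => ‖1 - inner ℂ (r • ζ) ξ‖ ^ (-s)
  have hFm : Measurable F := by
    have : Continuous fun ξ => ‖1 - inner ℂ (r • ζ) ξ‖ := by fun_prop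
    exact this.measurable.pow_const _
  have hw : ‖r • ζ‖ = r := by rw [norm_smul, hζ, mul_one, Real.norm_of_nonneg hr0]
  have hlow : ∀ ξ ∈ sphere (0 : CSpace d) 1, 1 - r ≤ ‖1 - inner ℂ (r • ζ) ξ‖ := fun ξ hξ => by
    have := one_sub_norm_mul_norm_le (r • ζ) ξ
    rwa [hw, mem_sphere_zero_iff_norm.1 hξ, mul_one] at this
  have hlevel : ∀ t, 0 < t → sphereMeasure d {ξ | t < F ξ} ≤
      (Set.Iio T).indicator
        (fun t => A * (ENNReal.ofReal (2 ^ d) * ENNReal.ofReal (t ^ (-(1 / p))))) t := by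
    intro t ht
    by_cases htT : t < T
    · rw [Set.indicator_of_mem (by exact htT)]
      have hpos : 0 < t ^ (-s⁻¹) := by positivity
      calc sphereMeasure d {ξ | t < F ξ}
          ≤ sphereMeasure d (nonisoBall ζ (2 * t ^ (-s⁻¹))) := by
            refine measure_mono_ae ?_
            filter_upwards [ae_mem_sphere_sphereMeasure d] with ξ hξ hξt
            refine ⟨hξ, ?_⟩
            have hX := hδ.trans_le (hlow ξ hξ)
            have h2 : ‖1 - inner ℂ (r • ζ) ξ‖ ≤ t ^ (-s⁻¹) := by
              have : t ≤ ‖1 - inner ℂ (r • ζ) ξ‖ ^ (-s) := le_of_lt hξt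
              have h3 := Real.rpow_le_rpow_of_nonpos ht this
                (show -s⁻¹ ≤ 0 by simp only [Left.neg_nonpos_iff]; positivity)
              rwa [← Real.rpow_mul hX.le, neg_mul_neg, mul_inv_cancel₀ hs0.ne',
                Real.rpow_one] at h3
            have h4 : ‖inner ℂ ζ ξ‖ ≤ 1 := by
              have := norm_inner_le_norm (𝕜 := ℂ) ζ ξ
              rwa [hζ, mem_sphere_zero_iff_norm.1 hξ, mul_one] at this
            have h5 := norm_one_sub_le_two_mul h4 hr0 hr1.le
            rw [← inner_realSmul_left] at h5
            rw [norm_one_sub_inner_comm]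
            linarith
        _ ≤ A * ENNReal.ofReal (2 * t ^ (-s⁻¹)) ^ d := hAσ ζ hζ _ (by positivity)
        _ = _ := by
            rw [ENNReal.ofReal_mul (by norm_num), mul_pow, ← ENNReal.ofReal_pow (by norm_num),
              ← ENNReal.ofReal_pow hpos.le, ← Real.rpow_natCast (t ^ (-s⁻¹)),
              ← Real.rpow_mul ht.le]
            congr 4
            rw [hs]; field_simp
    · rw [Set.indicator_of_notMem (by exact htT), nonpos_iff_eq_zero, measure_eq_zero_iff_ae_notMem]
      filter_upwards [ae_mem_sphere_sphereMeasure d] with ξ hξ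
      simp only [not_lt]
      exact (Real.rpow_le_rpow_of_nonpos hδ (hlow ξ hξ) (by linarith)).trans (not_lt.1 htT)
  calc kernelIntegral p (r • ζ)
      = ∫⁻ ξ, ENNReal.ofReal (F ξ) ∂(sphereMeasure d) := by
        refine lintegral_congr_ae ?_
        filter_upwards [ae_mem_sphere_sphereMeasure d] with ξ hξ
        exact enorm_cauchyKernel_rpow hp0 (hδ.trans_le (hlow ξ hξ))
    _ = ∫⁻ t in Set.Ioi 0, sphereMeasure d {ξ | t < F ξ} :=
        lintegral_eq_lintegral_meas_lt _ (.of_forall fun _ => by positivity) hFm.aemeasurable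
    _ ≤ ∫⁻ t in Set.Ioi 0, (Set.Iio T).indicator
        (fun t => A * (ENNReal.ofReal (2 ^ d) * ENNReal.ofReal (t ^ (-(1 / p))))) t :=
        setLIntegral_mono' measurableSet_Ioi fun t ht => hlevel t ht
    _ = A * (ENNReal.ofReal (2 ^ d) * ENNReal.ofReal (T ^ (1 - 1 / p) / (1 - 1 / p))) := by
        rw [lintegral_indicator measurableSet_Iio, Measure.restrict_restrict measurableSet_Iio,
          Set.inter_comm, Set.Ioi_inter_Iio, lintegral_const_mul' _ _ hA,
          lintegral_const_mul' _ _ ENNReal.ofReal_ne_top, lintegral_rpow_Ioo hp hT0]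
    _ ≤ (A + 1) * (ENNReal.ofReal (2 ^ d) * ENNReal.ofReal (T ^ (1 - 1 / p) / (1 - 1 / p))) := by
        gcongr; exact le_self_add
    _ = _ := by
        have : T ^ (1 - 1 / p) = (1 - r) ^ (d - d * p) := by
          rw [hT, ← Real.rpow_mul hδ.le]
          congr 1
          rw [hs]; field_simp; ring
        rw [this, div_eq_mul_one_div, ENNReal.ofReal_mul (by positivity)]
        ring

theorem exists_hardyNorm_cauchyKernel_le {d : ℕ} (hd : 1 ≤ d) {p : ℝ} (hp : 1 < p) :
    ∃ A : ℝ≥0∞, A ≠ 0 ∧ A ≠ ∞ ∧ ∀ ζ : CSpace d, ‖ζ‖ = 1 → ∀ r : ℝ, 0 ≤ r → r < 1 →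
      hardyNorm p (cauchyKernel (r • ζ)) ^ p ≤ A * ENNReal.ofReal ((1 - r) ^ (d - d * p)) := by
  obtain ⟨A, hA0, hA, hN⟩ := exists_kernelIntegral_le hd hp
  refine ⟨A, hA0, hA, fun ζ hζ r hr0 hr1 => ?_⟩
  rw [hardyNorm_cauchyKernel_rpow (by linarith)]
  refine iSup₂_le fun ρ hρ => ?_
  have hρr : ρ * r ≤ r := by nlinarith [hρ.2]
  rw [smul_smul]
  refine (hN ζ hζ (ρ * r) (by nlinarith [hρ.1]) (by linarith)).trans ?_
  refine mul_le_mul_right (ENNReal.ofReal_le_ofReal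
    (Real.rpow_le_rpow_of_nonpos (sub_pos.2 hr1) (sub_le_sub_left hρr 1) ?_)) A
  have : (0 : ℝ) ≤ d := by positivity
  nlinarith

theorem measure_nonisoBall_mul_le {d : ℕ} {p : ℝ} (hp : 0 < p) (μ : Measure (CSpace d))
    {ζ : CSpace d} (hζ : ‖ζ‖ = 1) {r : ℝ} (hr0 : 0 ≤ r) (hr1 : r < 1) :
    μ (nonisoBall ζ (1 - r)) * ENNReal.ofReal ((2 * (1 - r)) ^ (-(d * p))) ≤
      ∫⁻ z in nonisoBall ζ (1 - r), ‖cauchyKernel (r • ζ) z‖ₑ ^ p ∂μ := by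
  rw [mul_comm, ← setLIntegral_const]
  refine setLIntegral_mono' (isClosed_nonisoBall _ _).measurableSet fun ξ hξ => ?_
  have hw : ‖r • ζ‖ < 1 := by rwa [norm_smul, hζ, mul_one, Real.norm_of_nonneg hr0]
  have hpos := one_sub_inner_pos hw (mem_sphere_zero_iff_norm.1 hξ.1).le
  rw [enorm_cauchyKernel_rpow hp hpos]
  refine ENNReal.ofReal_le_ofReal (Real.rpow_le_rpow_of_nonpos hpos ?_
    (by simp only [Left.neg_nonpos_iff]; positivity))
  rw [inner_realSmul_left]
  refine norm_one_sub_mul_le hr0 hr1.le ?_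
  rw [norm_one_sub_inner_comm]
  exact hξ.2

theorem ofReal_pow_mul_ofReal_rpow {d : ℕ} {p δ : ℝ} (hδ : 0 < δ) :
    ENNReal.ofReal δ ^ d * ENNReal.ofReal ((2 * δ) ^ (-(d * p))) =
      ENNReal.ofReal (2 ^ (-(d * p))) * ENNReal.ofReal (δ ^ (d - d * p)) := by
  rw [Real.mul_rpow (by norm_num) hδ.le, ENNReal.ofReal_mul (by positivity),
    ← ENNReal.ofReal_pow hδ.le, sub_eq_add_neg, Real.rpow_add hδ, Real.rpow_natCast,
    ENNReal.ofReal_mul (by positivity)]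
  ring

/-- The part of the integral over `Q(ζ, 1 - r)` already has the right order. -/
theorem exists_le_kernelIntegral {d : ℕ} (hd : 1 ≤ d) {p : ℝ} (hp : 0 < p) :
    ∃ a : ℝ≥0∞, a ≠ 0 ∧ ∀ ζ : CSpace d, ‖ζ‖ = 1 → ∀ r : ℝ, 0 ≤ r → r < 1 →
      a * ENNReal.ofReal ((1 - r) ^ (d - d * p)) ≤ kernelIntegral p (r • ζ) := by
  obtain ⟨a, ha0, -, ha⟩ := exists_le_sphereMeasure_nonisoBall hd
  refine ⟨a * ENNReal.ofReal (2 ^ (-(d * p))), mul_ne_zero ha0 ?_, fun ζ hζ r hr0 hr1 => ?_⟩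
  · rw [ne_eq, ENNReal.ofReal_eq_zero, not_le]; positivity
  rw [mul_assoc, ← ofReal_pow_mul_ofReal_rpow (by linarith), ← mul_assoc]
  refine (mul_le_mul_left (ha ζ hζ (1 - r) (by linarith) (by linarith)) _).trans ?_
  exact (measure_nonisoBall_mul_le hp _ hζ hr0 hr1).trans (setLIntegral_le_lintegral _ _)

theorem exists_unit_smul_eq {d : ℕ} (hd : 1 ≤ d) (z : CSpace d) :
    ∃ u : CSpace d, ‖u‖ = 1 ∧ z = ‖z‖ • u := by
  rcases eq_or_ne z 0 with rfl | hz
  · exact ⟨EuclideanSpace.single ⟨0, hd⟩ 1, by simp, by simp⟩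
  · have h := norm_ne_zero_iff.2 hz
    refine ⟨‖z‖⁻¹ • z, ?_, ?_⟩
    · rw [norm_smul, norm_inv, norm_norm, inv_mul_cancel₀ h]
    · rw [smul_smul, mul_inv_cancel₀ h, one_smul]

theorem hardyNorm_cauchyKernel_rpow_ne_top {d : ℕ} (hd : 1 ≤ d) {p : ℝ} (hp : 1 < p)
    {w : CSpace d} (hw : ‖w‖ < 1) : hardyNorm p (cauchyKernel w) ^ p ≠ ∞ := by
  obtain ⟨A, -, hA, hM⟩ := exists_hardyNorm_cauchyKernel_le hd hp
  obtain ⟨ζ, hζ, hwζ⟩ := exists_unit_smul_eq hd w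
  rw [hwζ]
  exact ((hM ζ hζ ‖w‖ (norm_nonneg w) hw).trans_lt (by finiteness)).ne

/-! ### Normalized kernels: (i) ⇒ (ii) and (iii) ⇒ (ii) -/

theorem enorm_normalizedKernel_rpow {d : ℕ} (hd : 1 ≤ d) {p : ℝ} (hp : 1 < p)
    {w : CSpace d} (hw : ‖w‖ < 1) (z : CSpace d) :
    ‖normalizedKernel p w z‖ₑ ^ p =
      ‖cauchyKernel w z‖ₑ ^ p / hardyNorm p (cauchyKernel w) ^ p := by
  have hp0 : 0 < p := by linarith
  have h1 : hardyNorm p (cauchyKernel w) ≠ ∞ := fun h =>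
    hardyNorm_cauchyKernel_rpow_ne_top hd hp hw (by rw [h, ENNReal.top_rpow_of_pos hp0])
  have h0 : hardyNorm p (cauchyKernel w) ≠ 0 := fun h => by
    have := one_le_hardyNorm_cauchyKernel hd hp0 hw
    rw [h, ENNReal.zero_rpow_of_pos hp0] at this
    simp at this
  rw [← ENNReal.div_rpow_of_nonneg _ _ hp0.le]
  congr 1
  have hne : ((hardyNorm p (cauchyKernel w)).toReal : ℂ) ≠ 0 := by
    exact_mod_cast (ENNReal.toReal_pos h0 h1).ne'
  rw [normalizedKernel, div_eq_mul_inv, enorm_mul, enorm_inv hne, div_eq_mul_inv]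
  congr 2
  rw [← ofReal_norm, Complex.norm_real, Real.norm_of_nonneg ENNReal.toReal_nonneg,
    ENNReal.ofReal_toReal h1]

theorem memHardy_cauchyKernel {d : ℕ} (hd : 1 ≤ d) {p : ℝ} (hp : 1 < p)
    {w : CSpace d} (hw : ‖w‖ < 1) : MemHardy p (cauchyKernel w) := by
  refine ⟨differentiableOn_cauchyKernel hw, lt_top_iff_ne_top.2 fun h => ?_⟩
  exact hardyNorm_cauchyKernel_rpow_ne_top hd hp hw
    (by rw [h, ENNReal.top_rpow_of_pos (by linarith)])

theorem continuousOn_cauchyKernel {d : ℕ} {w : CSpace d} (hw : ‖w‖ < 1) :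
    ContinuousOn (cauchyKernel w) (closedBall 0 1) := fun _ hz =>
  (continuousAt_cauchyKernel hw (mem_closedBall_zero_iff.1 hz)).continuousWithinAt

theorem lintegral_normalizedKernel {d : ℕ} (hd : 1 ≤ d) {p : ℝ} (hp : 1 < p)
    (μ : Measure (CSpace d)) {w : CSpace d} (hw : ‖w‖ < 1) :
    ∫⁻ z, ‖normalizedKernel p w z‖ₑ ^ p ∂μ =
      (∫⁻ z, ‖cauchyKernel w z‖ₑ ^ p ∂μ) / hardyNorm p (cauchyKernel w) ^ p := by
  have hm : Measurable fun z => ‖cauchyKernel w z‖ₑ ^ p :=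
    (measurable_cauchyKernel_comp measurable_const measurable_id).enorm.pow_const p
  simp only [enorm_normalizedKernel_rpow hd hp hw, div_eq_mul_inv]
  exact lintegral_mul_const _ hm

theorem IsReverseCarleson.le_lintegral_normalizedKernel {d : ℕ} (hd : 1 ≤ d) {p : ℝ} (hp : 1 < p)
    {μ : Measure (CSpace d)} (h : IsReverseCarleson p μ) :
    ∃ C : ℝ≥0, 0 < C ∧ ∀ w ∈ ball (0 : CSpace d) 1,
      (C : ℝ≥0∞) ≤ ∫⁻ z in closedBall 0 1, ‖normalizedKernel p w z‖ₑ ^ p ∂μ := by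
  obtain ⟨C, hC, hCf⟩ := h
  refine ⟨C, hC, fun w hw => ?_⟩
  rw [mem_ball_zero_iff] at hw
  rw [lintegral_normalizedKernel hd hp _ hw, ENNReal.le_div_iff_mul_le
    (.inl (one_pos.trans_le (one_le_hardyNorm_cauchyKernel hd (by linarith) hw)).ne')
    (.inl (hardyNorm_cauchyKernel_rpow_ne_top hd hp hw))]
  exact hCf _ (continuousOn_cauchyKernel hw) (memHardy_cauchyKernel hd hp hw)

theorem exists_le_lintegral_normalizedKernel_of_nonisoBall {d : ℕ} (hd : 1 ≤ d) {p : ℝ}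
    (hp : 1 < p) {μ : Measure (CSpace d)} {C : ℝ≥0} (hC : 0 < C)
    (h : ∀ ζ ∈ sphere (0 : CSpace d) 1, ∀ δ : ℝ, 0 < δ →
      (C : ℝ≥0∞) * sphereMeasure d (nonisoBall ζ δ) ≤ μ (nonisoBall ζ δ)) :
    ∃ C : ℝ≥0, 0 < C ∧ ∀ w ∈ ball (0 : CSpace d) 1,
      (C : ℝ≥0∞) ≤ ∫⁻ z in closedBall 0 1, ‖normalizedKernel p w z‖ₑ ^ p ∂μ := by
  have hp0 : 0 < p := by linarith
  obtain ⟨A, hA0, hA, hM⟩ := exists_hardyNorm_cauchyKernel_le hd hp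
  obtain ⟨a, ha0, ha, haσ⟩ := exists_le_sphereMeasure_nonisoBall hd
  have h20 : ENNReal.ofReal (2 ^ (-(d * p))) ≠ 0 := by
    rw [ne_eq, ENNReal.ofReal_eq_zero, not_le]; positivity
  have hCne : (C : ℝ≥0∞) ≠ 0 := by exact_mod_cast hC.ne'
  set K : ℝ≥0∞ := C * a * ENNReal.ofReal (2 ^ (-(d * p))) / A with hK
  have hK0 : K ≠ 0 := ENNReal.div_ne_zero.2 ⟨mul_ne_zero (mul_ne_zero hCne ha0) h20, hA⟩
  have hKt : K ≠ ∞ := ENNReal.div_ne_top (by finiteness) hA0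
  refine ⟨K.toNNReal, ENNReal.toNNReal_pos hK0 hKt, fun w hw => ?_⟩
  rw [mem_ball_zero_iff] at hw
  rw [ENNReal.coe_toNNReal hKt, lintegral_normalizedKernel hd hp _ hw]
  obtain ⟨ζ, hζ, hwζ⟩ := exists_unit_smul_eq hd w
  have hδ : 0 < 1 - ‖w‖ := by linarith
  set X := ENNReal.ofReal ((1 - ‖w‖) ^ (d - d * p)) with hX
  have hX0 : X ≠ 0 := by rw [hX, ne_eq, ENNReal.ofReal_eq_zero, not_le]; positivity
  have hXt : X ≠ ∞ := ENNReal.ofReal_ne_top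
  have hnum : C * a * ENNReal.ofReal (2 ^ (-(d * p))) * X ≤
      ∫⁻ z in closedBall 0 1, ‖cauchyKernel w z‖ₑ ^ p ∂μ := by
    calc C * a * ENNReal.ofReal (2 ^ (-(d * p))) * X
        = C * (a * ENNReal.ofReal (1 - ‖w‖) ^ d) *
            ENNReal.ofReal ((2 * (1 - ‖w‖)) ^ (-(d * p))) := by
          rw [mul_assoc (C * a : ℝ≥0∞), hX, ← ofReal_pow_mul_ofReal_rpow hδ]; ring
      _ ≤ C * sphereMeasure d (nonisoBall ζ (1 - ‖w‖)) *
            ENNReal.ofReal ((2 * (1 - ‖w‖)) ^ (-(d * p))) := by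
          gcongr
          exact haσ ζ hζ _ hδ (by linarith [norm_nonneg w])
      _ ≤ μ (nonisoBall ζ (1 - ‖w‖)) * ENNReal.ofReal ((2 * (1 - ‖w‖)) ^ (-(d * p))) := by
          gcongr
          exact h ζ (mem_sphere_zero_iff_norm.2 hζ) _ hδ
      _ ≤ ∫⁻ z in nonisoBall ζ (1 - ‖w‖), ‖cauchyKernel (‖w‖ • ζ) z‖ₑ ^ p ∂μ :=
          measure_nonisoBall_mul_le hp0 μ hζ (norm_nonneg w) hw
      _ ≤ ∫⁻ z in closedBall 0 1, ‖cauchyKernel w z‖ₑ ^ p ∂μ := by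
          rw [← hwζ]
          exact lintegral_mono_set ((nonisoBall_subset_sphere _ _).trans sphere_subset_closedBall)
  have hden : hardyNorm p (cauchyKernel w) ^ p ≤ A * X := by
    have := hM ζ hζ ‖w‖ (norm_nonneg w) hw
    rwa [← hwζ] at this
  calc K = C * a * ENNReal.ofReal (2 ^ (-(d * p))) * X / (A * X) :=
        (ENNReal.mul_div_mul_right _ _ hX0 hXt).symm
    _ ≤ _ := ENNReal.div_le_div hnum hden

/-! ### Averaging over poles tending to the sphere -/

/-- Radii increasing to `1`. -/
noncomputable def radiusSeq (n : ℕ) : ℝ := 1 - 1 / (n + 2)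

theorem radiusSeq_nonneg (n : ℕ) : 0 ≤ radiusSeq n := by
  rw [radiusSeq, sub_nonneg, div_le_one (by positivity)]
  linarith [(Nat.cast_nonneg n : (0 : ℝ) ≤ n)]

theorem radiusSeq_lt_one (n : ℕ) : radiusSeq n < 1 := by
  rw [radiusSeq, sub_lt_self_iff]; positivity

theorem norm_radiusSeq_smul {d : ℕ} (n : ℕ) (z : CSpace d) :
    ‖radiusSeq n • z‖ = radiusSeq n * ‖z‖ := by
  rw [norm_smul, Real.norm_of_nonneg (radiusSeq_nonneg n)]

theorem tendsto_hardyNorm_cauchyKernel {d : ℕ} (hd : 1 ≤ d) {p : ℝ} (hp : 1 < p) {e : CSpace d}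
    (he : ‖e‖ = 1) :
    Tendsto (fun n => hardyNorm p (cauchyKernel (radiusSeq n • e)) ^ p) atTop (𝓝 ∞) := by
  have hp0 : 0 < p := by linarith
  obtain ⟨a, ha0, ha⟩ := exists_le_kernelIntegral hd hp0
  have h1 : ∀ n : ℕ, a * ENNReal.ofReal (((n : ℝ) + 2) ^ (d * p - d)) ≤
      hardyNorm p (cauchyKernel (radiusSeq n • e)) ^ p := fun n => by
    have h2 := ha e he _ (radiusSeq_nonneg n) (radiusSeq_lt_one n)
    have h3 := kernelIntegral_smul_le_hardyNorm hp0 (w := radiusSeq n • e)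
      (by rw [norm_radiusSeq_smul, he, mul_one]; exact radiusSeq_lt_one n)
      (r := 1) ⟨zero_le_one, le_rfl⟩
    rw [one_smul] at h3
    refine le_trans (le_of_eq ?_) (h2.trans h3)
    rw [radiusSeq, sub_sub_cancel, one_div, Real.inv_rpow (by positivity),
      ← Real.rpow_neg (by positivity), neg_sub]
  refine tendsto_nhds_top_mono' ?_ h1
  have h4 : Tendsto (fun n : ℕ => ((n : ℝ) + 2) ^ (d * p - d)) atTop atTop := by
    refine (tendsto_rpow_atTop ?_).comp
      (tendsto_atTop_add_const_right _ _ tendsto_natCast_atTop_atTop)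
    have : (1 : ℝ) ≤ d := by exact_mod_cast hd
    nlinarith
  have h5 := ENNReal.Tendsto.const_mul (a := a) (ENNReal.tendsto_ofReal_atTop.comp h4)
    (.inl ENNReal.top_ne_zero)
  rwa [ENNReal.mul_top ha0] at h5

/-- For unit vectors `Re (1 - ⟨ζ, z⟩) = dist ζ z ^ 2 / 2`; passing to the pole `r • ζ` loses another
factor `2`. Away from its pole the kernel is thus bounded uniformly in `r`. -/
theorem exists_le_norm_one_sub_inner_of_sphere {d : ℕ} {ζ z : CSpace d} (hζ : ‖ζ‖ = 1)
    (hz : ‖z‖ = 1) {η r : ℝ} (hη : 0 ≤ η) (h : η ≤ dist ζ z) (hr0 : 0 ≤ r) (hr1 : r ≤ 1) :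
    η ^ 2 / 4 ≤ ‖1 - inner ℂ (r • ζ) z‖ := by
  have h1 : ‖inner ℂ ζ z‖ ≤ 1 := by
    have := norm_inner_le_norm (𝕜 := ℂ) ζ z
    rwa [hζ, hz, mul_one] at this
  have h2 := norm_one_sub_le_two_mul h1 hr0 hr1
  rw [← inner_realSmul_left] at h2
  have h3 := Complex.re_le_norm (1 - inner ℂ ζ z)
  have h4 := norm_sub_sq (𝕜 := ℂ) ζ z
  rw [← dist_eq_norm, hζ, hz] at h4
  simp only [Complex.sub_re, Complex.one_re, RCLike.re_to_complex] at h3 h4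
  nlinarith

/-- Averages of `H` on the sphere against the normalized Cauchy kernels with pole `r_n ζ`. -/
noncomputable def kernelAverage {d : ℕ} (p : ℝ) (e : CSpace d) (H : CSpace d → ℝ≥0∞) (n : ℕ)
    (z : CSpace d) : ℝ≥0∞ :=
  (∫⁻ ζ, H ζ * ‖cauchyKernel (radiusSeq n • ζ) z‖ₑ ^ p ∂(sphereMeasure d)) /
    hardyNorm p (cauchyKernel (radiusSeq n • e)) ^ p

/-- With the symmetry of the kernel modulus, this says that the weights `|K_{r_n ζ}(z)|^p` have
total mass at most one in `ζ`. The norm does not depend on the direction of the pole, so a fixed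
unit vector `e` serves for all. -/
theorem kernelIntegral_radiusSeq_le {d : ℕ} (hd : 1 ≤ d) {p : ℝ} (hp : 0 < p) {e : CSpace d}
    (he : ‖e‖ = 1) {z : CSpace d} (hz : ‖z‖ ≤ 1) (n : ℕ) :
    kernelIntegral p (radiusSeq n • z) ≤ hardyNorm p (cauchyKernel (radiusSeq n • e)) ^ p := by
  obtain ⟨u, hu, hzu⟩ := exists_unit_smul_eq hd z
  rw [hardyNorm_cauchyKernel_congr hd hp _ he hu, hzu, smul_comm]
  refine kernelIntegral_smul_le_hardyNorm hp ?_ ⟨norm_nonneg z, hz⟩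
  rw [norm_radiusSeq_smul, hu, mul_one]
  exact radiusSeq_lt_one n

theorem norm_radiusSeq_smul_lt_one {d : ℕ} {e : CSpace d} (he : ‖e‖ = 1) (n : ℕ) :
    ‖radiusSeq n • e‖ < 1 := by
  rw [norm_radiusSeq_smul, he, mul_one]
  exact radiusSeq_lt_one n

theorem measurable_kernel_radiusSeq {d : ℕ} (p : ℝ) (n : ℕ) :
    Measurable fun x : CSpace d × CSpace d => ‖cauchyKernel (radiusSeq n • x.2) x.1‖ₑ ^ p := by
  have h1 : Measurable fun x : CSpace d × CSpace d => radiusSeq n • x.2 :=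
    (measurable_const_smul (radiusSeq n)).comp measurable_snd
  exact (measurable_cauchyKernel_comp h1 measurable_fst).enorm.pow_const p

theorem measurable_kernelAverage {d : ℕ} (hd : 1 ≤ d) (p : ℝ) (e : CSpace d)
    {H : CSpace d → ℝ≥0∞} (hH : Measurable H) (n : ℕ) : Measurable (kernelAverage p e H n) := by
  have := isProbabilityMeasure_sphereMeasure hd
  exact (((hH.comp measurable_snd).mul
    (measurable_kernel_radiusSeq p n)).lintegral_prod_right').div_const _

/-- `L` bounds `H` where the kernel may be large and is preserved, the weights having mass at most
one; `b` absorbs the region where the kernel stays bounded and is divided by the norm. -/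
theorem kernelAverage_le {d : ℕ} (hd : 1 ≤ d) {p : ℝ} (hp : 1 < p) {e : CSpace d}
    (he : ‖e‖ = 1) {H : CSpace d → ℝ≥0∞} {z : CSpace d} (hz : ‖z‖ ≤ 1) {n : ℕ} {L b : ℝ≥0∞}
    (h : ∀ ζ ∈ sphere (0 : CSpace d) 1, H ζ * ‖cauchyKernel (radiusSeq n • ζ) z‖ₑ ^ p ≤
      L * ‖cauchyKernel (radiusSeq n • ζ) z‖ₑ ^ p + b) :
    kernelAverage p e H n z ≤ L + b / hardyNorm p (cauchyKernel (radiusSeq n • e)) ^ p := by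
  have := isProbabilityMeasure_sphereMeasure hd
  have hw := norm_radiusSeq_smul_lt_one he n
  have hM0 := (one_pos.trans_le
    (one_le_hardyNorm_cauchyKernel hd (p := p) (by linarith) hw)).ne'
  have hMt := hardyNorm_cauchyKernel_rpow_ne_top hd hp hw
  have hm : Measurable fun ζ => ‖cauchyKernel (radiusSeq n • ζ) z‖ₑ ^ p :=
    (measurable_cauchyKernel_comp (measurable_const_smul _) measurable_const).enorm.pow_const p
  have h1 : ∫⁻ ζ, H ζ * ‖cauchyKernel (radiusSeq n • ζ) z‖ₑ ^ p ∂(sphereMeasure d) ≤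
      L * hardyNorm p (cauchyKernel (radiusSeq n • e)) ^ p + b := by
    calc _ ≤ ∫⁻ ζ, (L * ‖cauchyKernel (radiusSeq n • ζ) z‖ₑ ^ p + b) ∂(sphereMeasure d) := by
          refine lintegral_mono_ae ?_
          filter_upwards [ae_mem_sphere_sphereMeasure d] with ζ hζ using h ζ hζ
      _ = L * kernelIntegral p (radiusSeq n • z) + b := by
          rw [lintegral_add_right _ measurable_const, lintegral_const_mul _ hm,
            lintegral_cauchyKernel_swap]
          simp
      _ ≤ _ := by
          gcongr
          exact kernelIntegral_radiusSeq_le hd (by linarith) he hz n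
  refine (ENNReal.div_le_div_right h1 _).trans_eq ?_
  rw [ENNReal.add_div, ENNReal.mul_div_cancel_right hM0 hMt]

theorem limsup_kernelAverage_le {d : ℕ} (hd : 1 ≤ d) {p : ℝ} (hp : 1 < p) {e : CSpace d}
    (he : ‖e‖ = 1) {H : CSpace d → ℝ≥0∞} {z : CSpace d} (hz : ‖z‖ ≤ 1) {L b : ℝ≥0∞} (hb : b ≠ ∞)
    (h : ∀ n, ∀ ζ ∈ sphere (0 : CSpace d) 1, H ζ * ‖cauchyKernel (radiusSeq n • ζ) z‖ₑ ^ p ≤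
      L * ‖cauchyKernel (radiusSeq n • ζ) z‖ₑ ^ p + b) :
    limsup (fun n => kernelAverage p e H n z) atTop ≤ L := by
  have h1 : Tendsto
      (fun n => L + b / hardyNorm p (cauchyKernel (radiusSeq n • e)) ^ p) atTop (𝓝 L) := by
    have h2 := (ENNReal.Tendsto.const_div (a := b) (tendsto_hardyNorm_cauchyKernel hd hp he)
      (.inr hb)).const_add L
    rwa [ENNReal.div_top, add_zero] at h2
  rw [← h1.limsup_eq]
  exact limsup_le_limsup (.of_forall fun n => kernelAverage_le hd hp he hz (h n))

/-- For `‖z‖ < 1` the kernel is bounded uniformly in the pole, so `L = 0` works. For `‖z‖ = 1` and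
any `L > H z`, continuity gives `H ≤ L` near `z`, and the kernel is bounded for poles in the
remaining directions. -/
theorem limsup_kernelAverage_le_indicator {d : ℕ} (hd : 1 ≤ d) {p : ℝ} (hp : 1 < p) {e : CSpace d}
    (he : ‖e‖ = 1) {H : CSpace d → ℝ≥0∞} (hH : ContinuousOn H (sphere 0 1)) {B : ℝ≥0∞}
    (hB : B ≠ ∞) (hHB : ∀ ζ ∈ sphere (0 : CSpace d) 1, H ζ ≤ B) {z : CSpace d} (hz : ‖z‖ ≤ 1) :
    limsup (fun n => kernelAverage p e H n z) atTop ≤ (sphere 0 1).indicator H z := by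
  have hp0 : 0 < p := by linarith
  rcases hz.lt_or_eq with hlt | heq
  · have hnot : z ∉ sphere (0 : CSpace d) 1 := by
      rw [mem_sphere_zero_iff_norm]; exact hlt.ne
    rw [Set.indicator_of_notMem hnot]
    refine limsup_kernelAverage_le hd hp he hz
      (b := B * ENNReal.ofReal ((1 - ‖z‖) ^ (-(d * p)))) (by finiteness) fun n ζ hζ => ?_
    rw [zero_mul, zero_add]
    refine mul_le_mul' (hHB ζ hζ) (enorm_cauchyKernel_rpow_le hp0 (by linarith) ?_)
    refine le_trans ?_ (one_sub_norm_mul_norm_le _ _)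
    have := (norm_radiusSeq_smul_lt_one (mem_sphere_zero_iff_norm.1 hζ) n).le
    nlinarith [norm_nonneg z]
  · have hzs : z ∈ sphere (0 : CSpace d) 1 := mem_sphere_zero_iff_norm.2 heq
    rw [Set.indicator_of_mem hzs]
    refine le_of_forall_gt_imp_ge_of_dense fun L hL => ?_
    have hev := (hH z hzs).eventually_lt_const hL
    rw [eventually_nhdsWithin_iff, Metric.eventually_nhds_iff] at hev
    obtain ⟨η, hη, hηL⟩ := hev
    refine limsup_kernelAverage_le hd hp he hz
      (b := B * ENNReal.ofReal ((η ^ 2 / 4) ^ (-(d * p)))) (by finiteness) fun n ζ hζ => ?_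
    rcases lt_or_ge (dist ζ z) η with hd1 | hd1
    · exact le_add_right (mul_le_mul_left (hηL hd1 hζ).le _)
    · refine le_add_left (mul_le_mul' (hHB ζ hζ)
        (enorm_cauchyKernel_rpow_le hp0 (by positivity) ?_))
      exact exists_le_norm_one_sub_inner_of_sphere (mem_sphere_zero_iff_norm.1 hζ) heq hη.le hd1
        (radiusSeq_nonneg n) (radiusSeq_lt_one n).le

theorem lintegral_kernelAverage {d : ℕ} (hd : 1 ≤ d) {p : ℝ} (hp : 1 < p) {e : CSpace d}
    (he : ‖e‖ = 1) {H : CSpace d → ℝ≥0∞} (hH : Measurable H) (μ : Measure (CSpace d))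
    [IsFiniteMeasure μ] (n : ℕ) :
    ∫⁻ z, kernelAverage p e H n z ∂μ =
      ∫⁻ ζ, H ζ * ∫⁻ z, ‖normalizedKernel p (radiusSeq n • ζ) z‖ₑ ^ p ∂μ ∂(sphereMeasure d) := by
  have := isProbabilityMeasure_sphereMeasure hd
  have hp0 : 0 < p := by linarith
  have hm := measurable_kernel_radiusSeq (d := d) p n
  have hmH : Measurable fun x : CSpace d × CSpace d =>
      H x.2 * ‖cauchyKernel (radiusSeq n • x.2) x.1‖ₑ ^ p := (hH.comp measurable_snd).mul hm
  have hm2 : Measurable fun ζ : CSpace d =>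
      ∫⁻ z, H ζ * ‖cauchyKernel (radiusSeq n • ζ) z‖ₑ ^ p ∂μ :=
    (hmH.comp measurable_swap).lintegral_prod_right'
  simp only [kernelAverage, div_eq_mul_inv]
  rw [lintegral_mul_const _ hmH.lintegral_prod_right',
    lintegral_lintegral_swap hmH.aemeasurable,
    ← lintegral_mul_const _ hm2]
  refine lintegral_congr_ae ?_
  filter_upwards [ae_mem_sphere_sphereMeasure d] with ζ hζ
  have hζ1 := mem_sphere_zero_iff_norm.1 hζ
  rw [lintegral_normalizedKernel hd hp _ (norm_radiusSeq_smul_lt_one hζ1 n),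
    hardyNorm_cauchyKernel_congr hd hp0 _ hζ1 he, ← mul_div_assoc, div_eq_mul_inv]
  congr 1
  have hm3 : Measurable fun z => ‖cauchyKernel (radiusSeq n • ζ) z‖ₑ ^ p :=
    (measurable_cauchyKernel_comp measurable_const measurable_id).enorm.pow_const p
  exact lintegral_const_mul _ hm3

theorem mul_lintegral_sphereMeasure_le {d : ℕ} (hd : 1 ≤ d) {p : ℝ} (hp : 1 < p)
    {μ : Measure (CSpace d)} [IsFiniteMeasure μ] {C : ℝ≥0}
    (h : ∀ w ∈ ball (0 : CSpace d) 1,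
      (C : ℝ≥0∞) ≤ ∫⁻ z in closedBall 0 1, ‖normalizedKernel p w z‖ₑ ^ p ∂μ)
    {H : CSpace d → ℝ≥0∞} (hH : ContinuousOn H (sphere 0 1)) {B : ℝ≥0∞}
    (hB : B ≠ ∞) (hHB : ∀ ζ ∈ sphere (0 : CSpace d) 1, H ζ ≤ B) :
    C * ∫⁻ ζ, H ζ ∂(sphereMeasure d) ≤ ∫⁻ ζ in sphere 0 1, H ζ ∂μ := by
  obtain ⟨e, he, -⟩ := exists_unit_smul_eq hd (0 : CSpace d)
  have hp0 : 0 < p := by linarith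
  set ν := μ.restrict (closedBall 0 1) with hν
  set G : CSpace d → ℝ≥0∞ := (sphere 0 1).indicator H with hG
  have hGm : Measurable G := measurable_indicator_of_continuousOn isClosed_sphere.measurableSet hH
  have hGH : ∀ ζ ∈ sphere (0 : CSpace d) 1, G ζ = H ζ := fun ζ hζ => Set.indicator_of_mem hζ _
  have hGc : ContinuousOn G (sphere 0 1) := hH.congr hGH
  have hGB : ∀ ζ ∈ sphere (0 : CSpace d) 1, G ζ ≤ B := fun ζ hζ => (hGH ζ hζ).trans_le (hHB ζ hζ)
  have hmem : ∀ᵐ z ∂ν, ‖z‖ ≤ 1 := by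
    filter_upwards [ae_restrict_mem isClosed_closedBall.measurableSet] with z hz
    exact mem_closedBall_zero_iff.1 hz
  have hlow : ∀ n, C * ∫⁻ ζ, H ζ ∂(sphereMeasure d) ≤ ∫⁻ z, kernelAverage p e G n z ∂ν := by
    intro n
    rw [lintegral_kernelAverage hd hp he hGm, ← lintegral_const_mul' _ _ ENNReal.coe_ne_top]
    refine lintegral_mono_ae ?_
    filter_upwards [ae_mem_sphere_sphereMeasure d] with ζ hζ
    rw [hGH ζ hζ, mul_comm]
    gcongr
    exact h _ (mem_ball_zero_iff.2
      (norm_radiusSeq_smul_lt_one (mem_sphere_zero_iff_norm.1 hζ) n))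
  calc C * ∫⁻ ζ, H ζ ∂(sphereMeasure d)
      ≤ limsup (fun n => ∫⁻ z, kernelAverage p e G n z ∂ν) atTop :=
        le_limsup_of_frequently_le' (Frequently.of_forall hlow)
    _ ≤ ∫⁻ z, limsup (fun n => kernelAverage p e G n z) atTop ∂ν := by
        -- Reverse Fatou needs an integrable majorant: the averages are at most `B` on the closed
        -- ball, and `μ` is finite.
        refine limsup_lintegral_le (fun _ => B)
          (fun n => measurable_kernelAverage hd p e hGm n) (fun n => ?_) ?_
        · filter_upwards [hmem] with z hz
          refine (kernelAverage_le hd hp he hz (L := B) (b := 0) fun ζ hζ => ?_).trans_eq ?_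
          · rw [add_zero]; gcongr; exact hGB ζ hζ
          · simp
        · rw [lintegral_const]; finiteness
    _ ≤ ∫⁻ z, G z ∂ν := by
        refine lintegral_mono_ae ?_
        filter_upwards [hmem] with z hz
        refine (limsup_kernelAverage_le_indicator hd hp he hGc hB hGB hz).trans_eq ?_
        rw [hG, Set.indicator_indicator, Set.inter_self]
    _ = ∫⁻ ζ in sphere 0 1, H ζ ∂μ := by
        rw [hG, lintegral_indicator isClosed_sphere.measurableSet, hν,
          Measure.restrict_restrict isClosed_sphere.measurableSet,
          Set.inter_eq_left.2 sphere_subset_closedBall]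

/-! ### From the averaged inequality to (i), (iii) and the final claim -/

theorem isReverseCarleson_of_le_lintegral_normalizedKernel {d : ℕ} (hd : 1 ≤ d) {p : ℝ}
    (hp : 1 < p) {μ : Measure (CSpace d)} [IsFiniteMeasure μ] {C : ℝ≥0} (hC : 0 < C)
    (h : ∀ w ∈ ball (0 : CSpace d) 1,
      (C : ℝ≥0∞) ≤ ∫⁻ z in closedBall 0 1, ‖normalizedKernel p w z‖ₑ ^ p ∂μ) :
    IsReverseCarleson p μ := by
  refine ⟨C, hC, fun f hf hfH => ?_⟩
  obtain ⟨b, hb⟩ := (isCompact_closedBall (0 : CSpace d) 1).exists_bound_of_continuousOn hf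
  have hp0 : 0 < p := by linarith
  calc C * hardyNorm p f ^ p ≤ C * ∫⁻ ζ, ‖f ζ‖ₑ ^ p ∂(sphereMeasure d) := by
        gcongr; exact hardyNorm_rpow_le hd hp hfH.1 hf
    _ ≤ ∫⁻ ζ in sphere 0 1, ‖f ζ‖ₑ ^ p ∂μ := by
        refine mul_lintegral_sphereMeasure_le hd hp h
          ((ENNReal.continuous_rpow_const.comp continuous_enorm).comp_continuousOn
            (hf.mono sphere_subset_closedBall)) (B := ENNReal.ofReal b ^ p) (by finiteness)
          fun ζ hζ => ENNReal.rpow_le_rpow ?_ hp0.le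
        rw [← ofReal_norm]
        exact ENNReal.ofReal_le_ofReal (hb ζ (sphere_subset_closedBall hζ))
    _ ≤ ∫⁻ ζ in closedBall 0 1, ‖f ζ‖ₑ ^ p ∂μ := lintegral_mono_set sphere_subset_closedBall

/-- The indicator of a closed set is a limit of continuous functions with values in `[0, 1]`, to
which the averaged inequality applies with `B = 1`. -/
theorem mul_sphereMeasure_le_of_isClosed {d : ℕ} (hd : 1 ≤ d) {p : ℝ} (hp : 1 < p)
    {μ : Measure (CSpace d)} [IsFiniteMeasure μ] {C : ℝ≥0}
    (h : ∀ w ∈ ball (0 : CSpace d) 1,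
      (C : ℝ≥0∞) ≤ ∫⁻ z in closedBall 0 1, ‖normalizedKernel p w z‖ₑ ^ p ∂μ)
    {F : Set (CSpace d)} (hF : IsClosed F) : C * sphereMeasure d F ≤ μ F := by
  have := isProbabilityMeasure_sphereMeasure hd
  have h1 := ENNReal.Tendsto.const_mul (a := (C : ℝ≥0∞))
    (HasOuterApproxClosed.tendsto_lintegral_apprSeq hF (sphereMeasure d))
    (.inr ENNReal.coe_ne_top)
  have h2 := HasOuterApproxClosed.tendsto_lintegral_apprSeq hF (μ.restrict (sphere 0 1))
  refine (le_of_tendsto_of_tendsto' h1 h2 fun n => ?_).trans (Measure.restrict_apply_le _ _)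
  refine mul_lintegral_sphereMeasure_le hd hp h (B := 1) ?_ ENNReal.one_ne_top fun ζ _ => ?_
  · exact (ENNReal.continuous_coe.comp (hF.apprSeq n).continuous).continuousOn
  · exact_mod_cast HasOuterApproxClosed.apprSeq_apply_le_one hF n ζ

theorem theorem1 (d : ℕ) (hd : 1 ≤ d) (p : ℝ) (hp : 1 < p)
    (μ : Measure (CSpace d)) [IsFiniteMeasure μ]
    (hμ : μ (closedBall (0 : CSpace d) 1)ᶜ = 0) :
    List.TFAE [
      IsReverseCarleson p μ,
      ∃ C : ℝ≥0, 0 < C ∧ ∀ w ∈ ball (0 : CSpace d) 1,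
        (C : ℝ≥0∞) ≤ ∫⁻ z in closedBall 0 1, ‖normalizedKernel p w z‖ₑ ^ p ∂μ,
      ∃ C : ℝ≥0, 0 < C ∧ ∀ ζ ∈ sphere (0 : CSpace d) 1, ∀ δ : ℝ, 0 < δ →
        (C : ℝ≥0∞) * sphereMeasure d (nonisoBall ζ δ) ≤ μ (nonisoBall ζ δ)] ∧
    (μ (ball (0 : CSpace d) 1)ᶜ = 0 → ¬ IsReverseCarleson p μ) := by
  refine ⟨?_, fun hμ0 h => ?_⟩
  · tfae_have 1 → 2 := IsReverseCarleson.le_lintegral_normalizedKernel hd hp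
    tfae_have 2 → 1 := fun ⟨C, hC, h⟩ =>
      isReverseCarleson_of_le_lintegral_normalizedKernel hd hp hC h
    tfae_have 2 → 3 := fun ⟨C, hC, h⟩ => ⟨C, hC, fun ζ _ δ _ =>
      mul_sphereMeasure_le_of_isClosed hd hp h (isClosed_nonisoBall ζ δ)⟩
    tfae_have 3 → 2 := fun ⟨C, hC, h⟩ =>
      exists_le_lintegral_normalizedKernel_of_nonisoBall hd hp hC h
    tfae_finish
  · obtain ⟨C, hC, hCw⟩ := h.le_lintegral_normalizedKernel hd hp
    -- The whole sphere is a closed set of `σ`-measure one but `μ`-measure zero, which contradicts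
    -- `C > 0`.
    have hle := mul_sphereMeasure_le_of_isClosed hd hp hCw (F := sphere (0 : CSpace d) 1)
      isClosed_sphere
    have := isProbabilityMeasure_sphereMeasure hd
    have h1 : sphereMeasure d (sphere (0 : CSpace d) 1) = 1 :=
      (prob_compl_eq_zero_iff isClosed_sphere.measurableSet).1 (ae_mem_sphere_sphereMeasure d)
    have h2 : μ (sphere (0 : CSpace d) 1) = 0 := by
      refine measure_mono_null (fun z hz => ?_) hμ0
      rw [Set.mem_compl_iff, mem_ball_zero_iff, mem_sphere_zero_iff_norm.1 hz]
      exact lt_irrefl 1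
    rw [h1, h2, mul_one, nonpos_iff_eq_zero] at hle
    exact hC.ne' (by exact_mod_cast hle)
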